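/- Let $v:\mathbb R^3\to[0,\infty)$ be a bounded, measurable, radial function supported in $\{|x|\le R_0\}$, $R_0>0$, and let $\mu>0$. Let $f_0^\mu$ be the solution of the zero-energy scattering problem $(-\mu\Delta+v)f_0^\mu=0$ on $\mathbb R^3$, $\lim_{|x|\to\infty}f_0^\mu(x)=1$, and let $\mathfrak a_0^\mu:=\frac1{4\pi\mu}\int_{\mathbb R^3}v f_0^\mu\,dx$ be the scattering length. For $L>0$ let $$E_L^\mu:=\inf_{\varphi\in H^1(\{|x|\le L\}),\,\varphi\ne0}\frac{\int_{|x|\le L}(\mu|\nabla\varphi|^2+v\varphi^2)\,dx}{\int_{|x|\le L}\varphi^2\,dx}$$ and let $f_L^\mu$ be the positive Neumann ground state, i.e. the positive solution of $(-\mu\Delta+v)f_L^\mu=E_L^\mu f_L^\mu$ for $|x|<L$ with $f_L^\mu=1$ and $\partial_rf_L^\mu=0$ on $|x|=L$, extended by $f_L^\mu=1$ to $|x|\ge L$. (Both equations are understood weakly; the solutions are $C^1$.) Put $\zeta_0:=R_0^2\|v\|_{L^\infty}$ and let $\mathfrak c_0$ be the electrostatic capacity of the support of $v$, that is, $\mathfrak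 c_0=\inf\{\frac1{4\pi}\int|\nabla\varphi|^2dx:\varphi\in C_c^\infty(\mathbb R^3),\ \varphi\ge1\text{ on }\operatorname{supp}v\}$ (so $\mathfrak c_0=R_0$ if $v>0$ on $\{|x|<R_0\}$). There is a universal constant $C>0$ (independent of $v$, $R_0$, $\mu$, $L$) such that whenever $L\ge CR_0$: 1. $\displaystyle E_L^\mu\le\frac{3\mu\,\mathfrak a_0^\mu}{L^3}\Big(1+C\frac{R_0}{L}\Big)$. 2. For all $x$, $\exp(-\zeta_0^{1/2}/\mu^{1/2})\le f_L^\mu(x)\le1$; for all $x\neq0$, $1-f_L^\mu(x)\le\min\big(1-\exp(-\zeta_0^{1/2}/\mu^{1/2}),\ \mathfrak a_0^\mu/|x|\big)$; and for all $x$, $|f_0^\mu(x)-f_L^\mu(x)|\le C\,\mathfrak a_0^\mu/L$. 3. $\displaystyle\Big|\int v f_L^\mu\,dx-4\pi\mu\,\mathfrak a_0^\mu\Big|\le C\,\|v\|_{L^1}\frac{\mathfrak a_0^\mu}{L}$ and $\displaystyle\Big|\int v(f_L^\mu)^2dx-\int v(f_0^\mu)^2dx\Big|\le C R_0\frac{\mu\,\mathfrak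 a_0^\mu}{L}$. 4. For all $x\ne0$, $\displaystyle|\nabla f_L^\mu(x)|\le\frac{\mathfrak a_0^\mu(1+C R_0/L)}{|x|^2}$ and $\displaystyle|\nabla f_L^\mu(x)|\le\frac{2+C R_0/L}{|x|}$. 5. For all $x$, $\displaystyle|\nabla f_L^\mu(x)|\le\frac{C}{|x|^2+R_0^2}\Big(\mathfrak a_0^\mu+\frac{\mathfrak c_0-\mathfrak a_0^\mu}{\mu}\,\zeta_0\Big)$. -/

import Mathlib

open MeasureTheory Filter Topology

noncomputable section

/-- Three-dimensional Euclidean space. -/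
abbrev E3 : Type := EuclideanSpace ℝ (Fin 3)

/-- `f` solves the zero-energy scattering problem `(-μ Δ + v) f = 0` on `ℝ³`, `f(x) → 1` as
`|x| → ∞`. Since `v` is only bounded, the equation is understood in the weak sense; solutions are
`C¹` by elliptic regularity. -/
structure IsScatteringSolution (μ : ℝ) (v f : E3 → ℝ) : Prop where
  contDiff : ContDiff ℝ 1 f
  equation : ∀ φ : E3 → ℝ, ContDiff ℝ 1 φ → HasCompactSupport φ →
    ∫ x, (μ * inner ℝ (gradient f x) (gradient φ x) + v x * f x * φ x) = 0
  tendsto_one : Tendsto f (cocompact E3) (𝓝 1)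

/-- The scattering length `(4πμ)⁻¹ ∫ v f₀`, where `f₀` is the zero-energy scattering solution. -/
def scatteringLength (μ : ℝ) (v f₀ : E3 → ℝ) : ℝ :=
  1 / (4 * Real.pi * μ) * ∫ x, v x * f₀ x

/-- The Neumann ground state energy of `-μ Δ + v` on the ball `|x| ≤ L`: the infimum of the Rayleigh
quotient. (`C¹` functions on `ℝ³` restrict to a dense subspace of `H¹` of the ball, so this is
the infimum over `H¹`.) -/
def neumannEnergy (μ : ℝ) (v : E3 → ℝ) (L : ℝ) : ℝ :=
  sInf {q : ℝ | ∃ φ : E3 → ℝ, ContDiff ℝ 1 φ ∧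
    0 < ∫ x in Metric.closedBall 0 L, φ x ^ 2 ∧
    q = (∫ x in Metric.closedBall 0 L, (μ * ‖gradient φ x‖ ^ 2 + v x * φ x ^ 2)) /
      ∫ x in Metric.closedBall 0 L, φ x ^ 2}

/-- `f` is the positive ground state of the Neumann problem `(-μ Δ + v) f = E f` on `|x| ≤ L`,
where `E` is the ground state energy, normalized by `f = 1` on `|x| = L` and extended by `1` to
`|x| ≥ L`. The equation is in weak form, with test functions that need not vanish on the boundary.
Because `f = 1` and `∂_r f = 0` on `|x| = L`, the extended function is `C¹` on `ℝ³`. -/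
structure IsNeumannGroundState (μ : ℝ) (v : E3 → ℝ) (L : ℝ) (f : E3 → ℝ) : Prop where
  contDiff : ContDiff ℝ 1 f
  pos : ∀ x, ‖x‖ ≤ L → 0 < f x
  equation : ∀ φ : E3 → ℝ, ContDiff ℝ 1 φ →
    ∫ x in Metric.closedBall 0 L,
        (μ * inner ℝ (gradient f x) (gradient φ x) + v x * f x * φ x) =
      neumannEnergy μ v L * ∫ x in Metric.closedBall 0 L, f x * φ x
  eq_one : ∀ x, L ≤ ‖x‖ → f x = 1
  radial_deriv : ∀ x, ‖x‖ = L → fderiv ℝ f x x = 0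

/-- The electrostatic (Newtonian) capacity of a compact set `K ⊆ ℝ³`, normalized so that a ball of
radius `R` has capacity `R`. -/
def electrostaticCapacity (K : Set E3) : ℝ :=
  sInf {c : ℝ | ∃ φ : E3 → ℝ, ContDiff ℝ (⊤ : ℕ∞) φ ∧ HasCompactSupport φ ∧
    (∀ x ∈ K, 1 ≤ φ x) ∧ c = 1 / (4 * Real.pi) * ∫ x, ‖gradient φ x‖ ^ 2}

/-- `ζ₀ = R₀² ‖v‖_{L^∞}`. -/
def zetaZero (R₀ : ℝ) (v : E3 → ℝ) : ℝ :=
  R₀ ^ 2 * (eLpNorm v ⊤ volume).toReal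

end

/-!
Both solutions are unique, by a weak maximum principle for `f₀` and by Picone's identity for the
ground state, and the class of solutions is invariant under linear isometries, so both are radial:
`f₀ x = F ‖x‖` and `f x = G ‖x‖`. The equations become `r² F' = ∫₀ʳ (v / μ) F s² ds` and the same
for `G` with `(v - E) / μ`, so that `F = 1 - a / r` outside the support of `v`, where `a = R² F'(R)`
is the scattering length. The Wronskian identity
`r² (G' F - F' G) = -(E / μ) ∫₀ʳ G F s² ds ≤ 0` shows that `G / F` decreases, while the lower bound
on its derivative shows that it varies only by `O(a / L)`. At `r = L` the identity reads
`a = (E / μ) ∫₀ᴸ G F s² ds`, which bounds the energy, and comparing `G` with `F` yields all the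
pointwise estimates.

For the bound by the capacity, `F(R) = 1 - a / R` and the equation inside the support give
`F' ≤ ‖v‖_∞ (R - a) / (3 μ)`, where `R` may be taken to be the radius of the outermost sphere in the
support of `v`, and the capacity of a compact set containing that sphere is at least `R`, by a
one-dimensional estimate along rays.
-/

open scoped Gradient
/-! ### One-variable calculus -/

section Calculus

lemma integral_mul_deriv_add_mul_of_primitive {p q η : ℝ → ℝ} {a b : ℝ} (hab : a ≤ b)
    (hq : IntervalIntegrable q volume a b) (hη : AbsolutelyContinuousOnInterval η a b)
    (hp : ∀ x ∈ Set.Icc a b, p x = p a + ∫ s in a..x, q s) :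
    ∫ x in a..b, (p x * deriv η x + q x * η x) = p b * η b - p a * η a := by
  have ha : a ∈ Set.uIcc a b := Set.left_mem_uIcc
  have hP : AbsolutelyContinuousOnInterval (fun x => p a + ∫ s in a..x, q s) a b :=
    AbsolutelyContinuousOnInterval.add contDiffOn_const.absolutelyContinuousOnInterval
      (hq.absolutelyContinuousOnInterval_intervalIntegral ha)
  have parts := hP.integral_deriv_mul_eq_sub hη
  rw [← hp b ⟨hab, le_rfl⟩, ← hp a ⟨le_rfl, hab⟩] at parts
  rw [← parts]
  refine intervalIntegral.integral_congr_ae ?_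
  filter_upwards [hq.ae_hasDerivAt_integral] with x hx hxab
  have hx' : x ∈ Set.uIcc a b := Set.uIoc_subset_uIcc hxab
  rw [((hx hx' a ha).const_add (p a)).deriv, ← hp x (by rwa [Set.uIcc_of_le hab] at hx')]
  ring

lemma le_mul_exp_of_le_add_integral {y : ℝ → ℝ} {A κ T : ℝ} (hκ : 0 ≤ κ) (hT : 0 ≤ T)
    (hy : Continuous y) (h : ∀ r ∈ Set.Icc 0 T, y r ≤ A + κ * ∫ s in (0 : ℝ)..r, y s) :
    y T ≤ A * Real.exp (κ * T) := by
  let Y : ℝ → ℝ := fun r => A + κ * ∫ s in (0 : ℝ)..r, y s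
  have hY : ∀ r, HasDerivAt Y (κ * y r) r := fun r =>
    ((hy.integral_hasStrictDerivAt 0 r).hasDerivAt.const_mul κ).const_add A
  have gronwall := le_gronwallBound_of_liminf_deriv_right_le (f := Y) (δ := A) (K := κ) (ε := 0)
    (a := 0) (b := T) (fun r _ => (hY r).continuousAt.continuousWithinAt)
    (fun r _ c hc => (hY r).hasDerivWithinAt.liminf_right_slope_le hc) (by simp [Y])
    (fun r hr => by
      simpa only [add_zero] using mul_le_mul_of_nonneg_left (h r (Set.Ico_subset_Icc_self hr)) hκ)
  have hYT := gronwall T (Set.right_mem_Icc.2 hT)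
  rw [gronwallBound_ε0, sub_zero] at hYT
  exact (h T (Set.right_mem_Icc.2 hT)).trans hYT

end Calculus

/-! ### The radial zero-energy equation -/

/-- A bounded measurable nonnegative potential, on the line or on the whole space. -/
structure IsBoundedPotential {X : Type*} [MeasurableSpace X] (w : X → ℝ) : Prop where
  measurable : Measurable w
  nonneg : ∀ x, 0 ≤ w x
  bdd : ∃ B, ∀ x, w x ≤ B

lemma IsBoundedPotential.intervalIntegrable {w : ℝ → ℝ} (hw : IsBoundedPotential w) (a b : ℝ) :
    IntervalIntegrable w volume a b := by
  obtain ⟨B, hB⟩ := hw.bdd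
  refine (intervalIntegrable_const (c := B)).mono_fun hw.measurable.aestronglyMeasurable
    (Eventually.of_forall fun r => ?_)
  simpa only [Real.norm_of_nonneg (hw.nonneg r),
    Real.norm_of_nonneg ((hw.nonneg r).trans (hB r))] using hB r

lemma integral_mul_le_mul_integral_of_ae_le {w g : ℝ → ℝ} {K r : ℝ} (hr : 0 ≤ r)
    (hw : IntervalIntegrable w volume 0 r) (hg : Continuous g) (hg0 : ∀ s ∈ Set.Icc 0 r, 0 ≤ g s)
    (hK : ∀ᵐ s, 0 < s → w s ≤ K) :
    ∫ s in (0 : ℝ)..r, w s * g s ≤ K * ∫ s in (0 : ℝ)..r, g s := by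
  rw [← intervalIntegral.integral_const_mul, intervalIntegral.integral_of_le hr,
    intervalIntegral.integral_of_le hr]
  refine setIntegral_mono_on_ae (hw.mul_continuousOn hg.continuousOn).1
    ((hg.const_mul K).intervalIntegrable _ _).1 measurableSet_Ioc ?_
  filter_upwards [hK] with s hs hsr
  exact mul_le_mul_of_nonneg_right (hs hsr.1) (hg0 s (Set.Ioc_subset_Icc_self hsr))

/-- The outward flux `r² F'(r)` of the radial function `F` in dimension three, up to `4π`. -/
noncomputable def radialFlux (F : ℝ → ℝ) (r : ℝ) : ℝ :=
  r ^ 2 * deriv F r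

lemma continuous_radialFlux {F : ℝ → ℝ} (hF : ContDiff ℝ 1 F) : Continuous (radialFlux F) :=
  (continuous_pow 2).mul (hF.continuous_deriv le_rfl)

lemma hasDerivAt_add_div {F : ℝ → ℝ} {s : ℝ} (hF : DifferentiableAt ℝ F s) (c : ℝ) (hs : s ≠ 0) :
    HasDerivAt (fun s => F s + c / s) ((radialFlux F s - c) / s ^ 2) s := by
  refine (hF.hasDerivAt.add ((hasDerivAt_inv hs).const_mul c)).congr_deriv ?_
  rw [radialFlux]
  field_simp
  ring

/-- The radial form of `ΔF = w F` on the ball of radius `T` in dimension three, integrated once so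
that `w` need not be continuous. -/
structure IsRadialSolutionOn (w F : ℝ → ℝ) (T : ℝ) : Prop where
  intervalIntegrable : IntervalIntegrable w volume 0 T
  contDiff : ContDiff ℝ 1 F
  flux_eq : ∀ r, 0 ≤ r → r ≤ T → radialFlux F r = ∫ s in (0 : ℝ)..r, w s * (F s * s ^ 2)

namespace IsRadialSolutionOn

variable {w u F G : ℝ → ℝ} {T r s : ℝ}

lemma intervalIntegrable_mul (S : IsRadialSolutionOn w F T) (hr : 0 ≤ r) (hrs : r ≤ s)
    (hs : s ≤ T) {g : ℝ → ℝ} (hg : Continuous g) :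
    IntervalIntegrable (fun t => w t * g t) volume r s := by
  refine (S.intervalIntegrable.mono_set ?_).mul_continuousOn hg.continuousOn
  rw [Set.uIcc_of_le hrs, Set.uIcc_of_le (hr.trans (hrs.trans hs))]
  exact Set.Icc_subset_Icc hr hs

lemma flux_sub (S : IsRadialSolutionOn w F T) (hr : 0 ≤ r) (hrs : r ≤ s) (hs : s ≤ T) :
    radialFlux F s - radialFlux F r = ∫ t in r..s, w t * (F t * t ^ 2) := by
  have hc : Continuous fun t => F t * t ^ 2 := S.contDiff.continuous.mul (continuous_pow 2)
  rw [S.flux_eq s (hr.trans hrs) hs, S.flux_eq r hr (hrs.trans hs)]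
  exact intervalIntegral.integral_interval_sub_left
    (S.intervalIntegrable_mul le_rfl (hr.trans hrs) hs hc)
    (S.intervalIntegrable_mul le_rfl hr (hrs.trans hs) hc)

lemma integral_flux_mul_deriv_add (S : IsRadialSolutionOn w F T) (hr : 0 ≤ r) (hrs : r ≤ s)
    (hs : s ≤ T) {η : ℝ → ℝ} (hη : AbsolutelyContinuousOnInterval η r s) :
    ∫ t in r..s, (radialFlux F t * deriv η t + w t * (F t * t ^ 2) * η t) =
      radialFlux F s * η s - radialFlux F r * η r :=
  integral_mul_deriv_add_mul_of_primitive hrs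
    (S.intervalIntegrable_mul hr hrs hs (S.contDiff.continuous.mul (continuous_pow 2))) hη
    fun x hx => by linarith [S.flux_sub hr hx.1 (hx.2.trans hs)]

lemma wronskian (S : IsRadialSolutionOn w F T) (N : IsRadialSolutionOn u G T) (hr : 0 ≤ r)
    (hrT : r ≤ T) :
    radialFlux G r * F r - radialFlux F r * G r =
      ∫ s in (0 : ℝ)..r, (u s - w s) * (G s * F s * s ^ 2) := by
  have hF := S.contDiff.continuous
  have hG := N.contDiff.continuous
  have hF' := S.contDiff.continuous_deriv le_rfl
  have hG' := N.contDiff.continuous_deriv le_rfl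
  have hJF := continuous_radialFlux S.contDiff
  have hJG := continuous_radialFlux N.contDiff
  have partsG := N.integral_flux_mul_deriv_add le_rfl hr hrT
    S.contDiff.contDiffOn.absolutelyContinuousOnInterval
  have partsF := S.integral_flux_mul_deriv_add le_rfl hr hrT
    N.contDiff.contDiffOn.absolutelyContinuousOnInterval
  have zeroFlux : ∀ H : ℝ → ℝ, radialFlux H 0 = 0 := fun H => by simp [radialFlux]
  rw [zeroFlux, zero_mul, sub_zero] at partsF partsG
  rw [← partsF, ← partsG, ← intervalIntegral.integral_sub]
  · refine intervalIntegral.integral_congr fun s _ => ?_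
    simp only [radialFlux]
    ring
  · exact ((hJG.mul hF').intervalIntegrable _ _).add ((N.intervalIntegrable_mul le_rfl hr hrT
      (hG.mul (continuous_pow 2))).mul_continuousOn hF.continuousOn)
  · exact ((hJF.mul hG').intervalIntegrable _ _).add ((S.intervalIntegrable_mul le_rfl hr hrT
      (hF.mul (continuous_pow 2))).mul_continuousOn hG.continuousOn)

lemma add_mul_deriv_sub (S : IsRadialSolutionOn w F T) (hr : 0 < r) (hrs : r ≤ s) (hs : s ≤ T) :
    F s + s * deriv F s - (F r + r * deriv F r) = ∫ t in r..s, w t * (F t * t) := by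
  have hne : ∀ t ∈ Set.Icc r s, t ≠ 0 := fun t ht => (hr.trans_le ht.1).ne'
  have hF := S.contDiff.continuous
  have hF' := S.contDiff.continuous_deriv le_rfl
  have hc : Continuous fun t => F t * t := hF.mul continuous_id
  have hinv : ContDiffOn ℝ 1 (fun t : ℝ => t⁻¹) (Set.uIcc r s) := by
    rw [Set.uIcc_of_le hrs]
    exact contDiffOn_id.inv hne
  have parts :=
    S.integral_flux_mul_deriv_add hr.le hrs hs hinv.absolutelyContinuousOnInterval
  have integrand : Set.EqOn
      (fun t => radialFlux F t * deriv (fun t => t⁻¹) t + w t * (F t * t ^ 2) * t⁻¹)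
      (fun t => w t * (F t * t) - deriv F t) (Set.uIcc r s) := fun t ht => by
    have := hne t (by rwa [Set.uIcc_of_le hrs] at ht)
    simp only [radialFlux, deriv_inv]
    field_simp
    ring
  rw [intervalIntegral.integral_congr integrand, intervalIntegral.integral_sub
    (S.intervalIntegrable_mul hr.le hrs hs hc)
    (hF'.intervalIntegrable _ _), intervalIntegral.integral_deriv_eq_sub
    (fun t _ => S.contDiff.differentiable one_ne_zero t) (hF'.intervalIntegrable _ _)] at parts
  have flux_mul_inv : ∀ t, t ≠ 0 → radialFlux F t * t⁻¹ = t * deriv F t := fun t ht => by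
    rw [radialFlux]
    field_simp
  rw [flux_mul_inv s (hr.trans_le hrs).ne', flux_mul_inv r hr.ne'] at parts
  linarith

/-- In terms of `u = r F` this is `u' = u'(0) + ∫ w u`. -/
lemma add_mul_deriv_eq (S : IsRadialSolutionOn w F T) (hr : 0 ≤ r) (hrT : r ≤ T) :
    F r + r * deriv F r = F 0 + ∫ s in (0 : ℝ)..r, w s * (F s * s) := by
  rcases hr.eq_or_lt with rfl | hr
  · simp
  have hF := S.contDiff.continuous
  have hF' := S.contDiff.continuous_deriv le_rfl
  have integrable : IntegrableOn (fun s => w s * (F s * s)) (Set.uIcc 0 r) := by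
    rw [Set.uIcc_of_le hr.le, ← intervalIntegrable_iff_integrableOn_Icc_of_le hr.le]
    exact S.intervalIntegrable_mul le_rfl hr.le hrT (hF.mul continuous_id)
  have primitive : ContinuousOn (fun ε => ∫ s in ε..r, w s * (F s * s)) (Set.uIcc 0 r) :=
    (intervalIntegral.continuousOn_primitive_interval_left integrable)
  have limit : Tendsto (fun ε => F ε + ε * deriv F ε + ∫ s in ε..r, w s * (F s * s)) (𝓝[>] 0)
      (𝓝 (F 0 + 0 * deriv F 0 + ∫ s in (0 : ℝ)..r, w s * (F s * s))) := by
    refine ((hF.add (continuous_id.mul hF')).continuousWithinAt.tendsto).add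
      ((primitive 0 Set.left_mem_uIcc).tendsto.mono_left ?_)
    rw [Set.uIcc_of_le hr.le]
    exact nhdsWithin_le_of_mem (mem_of_superset (Ioc_mem_nhdsGT hr) Set.Ioc_subset_Icc_self)
  have constant : Tendsto (fun ε => F ε + ε * deriv F ε + ∫ s in ε..r, w s * (F s * s)) (𝓝[>] 0)
      (𝓝 (F r + r * deriv F r)) := by
    refine tendsto_const_nhds.congr' ?_
    filter_upwards [Ioo_mem_nhdsGT hr] with ε hε
    linarith [S.add_mul_deriv_sub hε.1 hε.2.le hrT]
  simpa only [zero_mul, add_zero] using tendsto_nhds_unique constant limit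

end IsRadialSolutionOn

/-! ### The radial scattering solution -/

/-- `F` is the radial profile of the zero-energy scattering solution for the potential `w`
supported in `[0, R]`; its scattering length is `radialFlux F R`. -/
structure IsRadialScattering (w F : ℝ → ℝ) (R : ℝ) : Prop where
  potential : IsBoundedPotential w
  radius_pos : 0 < R
  eq_zero : ∀ r, R < r → w r = 0
  contDiff : ContDiff ℝ 1 F
  flux_eq : ∀ r, 0 ≤ r → radialFlux F r = ∫ s in (0 : ℝ)..r, w s * (F s * s ^ 2)
  sol_nonneg : ∀ r, 0 ≤ r → 0 ≤ F r
  tendsto_one : Tendsto F atTop (𝓝 1)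

namespace IsRadialScattering

variable {w F : ℝ → ℝ} {R r s c κ : ℝ}

lemma isRadialSolutionOn (S : IsRadialScattering w F R) (T : ℝ) : IsRadialSolutionOn w F T where
  intervalIntegrable := S.potential.intervalIntegrable 0 T
  contDiff := S.contDiff
  flux_eq r hr _ := S.flux_eq r hr

lemma differentiable (S : IsRadialScattering w F R) : Differentiable ℝ F :=
  S.contDiff.differentiable one_ne_zero

lemma flux_mono (S : IsRadialScattering w F R) (hr : 0 ≤ r) (hrs : r ≤ s) :
    radialFlux F r ≤ radialFlux F s := by
  rw [← sub_nonneg, (S.isRadialSolutionOn s).flux_sub hr hrs le_rfl]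
  refine intervalIntegral.integral_nonneg hrs fun t ht => ?_
  have := S.sol_nonneg t (hr.trans ht.1)
  have := S.potential.nonneg t
  positivity

lemma flux_eq_of_le (S : IsRadialScattering w F R) (hs : R ≤ s) :
    radialFlux F s = radialFlux F R := by
  rw [← sub_eq_zero, (S.isRadialSolutionOn s).flux_sub S.radius_pos.le hs le_rfl,
    intervalIntegral.integral_of_le hs]
  exact setIntegral_eq_zero_of_forall_eq_zero fun t ht => by rw [S.eq_zero t ht.1, zero_mul]

lemma flux_nonneg (S : IsRadialScattering w F R) (hr : 0 ≤ r) : 0 ≤ radialFlux F r := by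
  simpa [radialFlux] using S.flux_mono le_rfl hr

lemma flux_le (S : IsRadialScattering w F R) (hr : 0 ≤ r) : radialFlux F r ≤ radialFlux F R := by
  rcases le_total r R with h | h
  · exact S.flux_mono hr h
  · exact (S.flux_eq_of_le h).le

lemma deriv_nonneg (S : IsRadialScattering w F R) (hr : 0 < r) : 0 ≤ deriv F r :=
  nonneg_of_mul_nonneg_right (S.flux_nonneg hr.le) (by positivity)

lemma monotoneOn (S : IsRadialScattering w F R) : MonotoneOn F (Set.Ici 0) := by
  refine monotoneOn_of_deriv_nonneg (convex_Ici 0) S.contDiff.continuous.continuousOn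
    S.differentiable.differentiableOn fun r hr => S.deriv_nonneg ?_
  rwa [interior_Ici] at hr

lemma le_one (S : IsRadialScattering w F R) (hr : 0 ≤ r) : F r ≤ 1 :=
  ge_of_tendsto S.tendsto_one (by
    filter_upwards [eventually_ge_atTop r] with s hs
    exact S.monotoneOn hr (Set.mem_Ici.2 (hr.trans hs)) hs)

lemma tendsto_add_div (S : IsRadialScattering w F R) (c : ℝ) :
    Tendsto (fun s => F s + c / s) atTop (𝓝 1) := by
  simpa using S.tendsto_one.add (tendsto_const_nhds (x := c).div_atTop tendsto_id)

lemma hasDerivWithinAt_add_div (S : IsRadialScattering w F R) (c : ℝ) (hr : 0 < r)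
    (D : Set ℝ) (hs : s ∈ Set.Ici r) :
    HasDerivWithinAt (fun s => F s + c / s) ((radialFlux F s - c) / s ^ 2) D s :=
  (hasDerivAt_add_div (S.differentiable s) c (hr.trans_le hs).ne').hasDerivWithinAt

lemma add_div_le_one (S : IsRadialScattering w F R) (hr : 0 < r)
    (hc : ∀ s, r ≤ s → c ≤ radialFlux F s) : F r + c / r ≤ 1 := by
  have monotone : MonotoneOn (fun s => F s + c / s) (Set.Ici r) :=
    monotoneOn_of_hasDerivWithinAt_nonneg (convex_Ici r)
      (fun s hs => (S.hasDerivWithinAt_add_div c hr _ hs).continuousWithinAt)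
      (fun s hs => S.hasDerivWithinAt_add_div c hr _ (interior_subset hs))
      fun s hs => div_nonneg (sub_nonneg.2 (hc s (interior_subset hs))) (sq_nonneg s)
  refine ge_of_tendsto (S.tendsto_add_div c) ?_
  filter_upwards [eventually_ge_atTop r] with s hs using monotone Set.self_mem_Ici hs hs

lemma one_le_add_div (S : IsRadialScattering w F R) (hr : 0 < r)
    (hc : ∀ s, r ≤ s → radialFlux F s ≤ c) : 1 ≤ F r + c / r := by
  have antitone : AntitoneOn (fun s => F s + c / s) (Set.Ici r) :=
    antitoneOn_of_hasDerivWithinAt_nonpos (convex_Ici r)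
      (fun s hs => (S.hasDerivWithinAt_add_div c hr _ hs).continuousWithinAt)
      (fun s hs => S.hasDerivWithinAt_add_div c hr _ (interior_subset hs))
      fun s hs => div_nonpos_of_nonpos_of_nonneg (sub_nonpos.2 (hc s (interior_subset hs)))
        (sq_nonneg s)
  refine le_of_tendsto (S.tendsto_add_div c) ?_
  filter_upwards [eventually_ge_atTop r] with s hs using antitone Set.self_mem_Ici hs hs

lemma one_sub_div_le (S : IsRadialScattering w F R) (hr : 0 < r) :
    1 - radialFlux F R / r ≤ F r := by
  linarith [S.one_le_add_div hr fun s hs => S.flux_le (hr.le.trans hs)]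

lemma eq_one_sub_div (S : IsRadialScattering w F R) (hr : R ≤ r) :
    F r = 1 - radialFlux F R / r := by
  have hr0 := S.radius_pos.trans_le hr
  linarith [S.one_sub_div_le hr0,
    S.add_div_le_one hr0 fun s hs => (S.flux_eq_of_le (hr.trans hs)).ge]

lemma mul_deriv_le (S : IsRadialScattering w F R) (hr : 0 < r) : r * deriv F r ≤ 1 := by
  have h := S.add_div_le_one hr fun s hs => S.flux_mono hr.le hs
  have : radialFlux F r / r = r * deriv F r := by
    rw [radialFlux]
    field_simp
  linarith [S.sol_nonneg r hr.le]

lemma length_nonneg (S : IsRadialScattering w F R) : 0 ≤ radialFlux F R :=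
  S.flux_nonneg S.radius_pos.le

lemma length_le (S : IsRadialScattering w F R) : radialFlux F R ≤ R := by
  rw [radialFlux]
  nlinarith [S.mul_deriv_le S.radius_pos, S.radius_pos]

/-- Gronwall's inequality for `u' + κ u`, where `u = r F` satisfies `u'' = w u ≤ κ² u`. -/
lemma exp_neg_le (S : IsRadialScattering w F R) (hκ : 0 ≤ κ) (hw : ∀ᵐ s, 0 < s → w s ≤ κ ^ 2) :
    Real.exp (-(κ * R)) ≤ F 0 := by
  have hF := S.contDiff.continuous
  have hF' := S.contDiff.continuous_deriv le_rfl
  have hR := S.radius_pos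
  have integral_le : ∀ r ∈ Set.Icc 0 R, F r + r * deriv F r + κ * (F r * r) ≤
      F 0 + κ * ∫ s in (0 : ℝ)..r, (F s + s * deriv F s + κ * (F s * s)) := by
    intro r hr
    have hu' : ∀ s, HasDerivAt (fun s => F s * s) (F s + s * deriv F s) s := fun s =>
      ((S.differentiable s).hasDerivAt.mul (hasDerivAt_id s)).congr_deriv (by simp; ring)
    have integral_u' : ∫ s in (0 : ℝ)..r, (F s + s * deriv F s) = F r * r := by
      rw [intervalIntegral.integral_eq_sub_of_hasDerivAt (fun s _ => hu' s)
        (Continuous.intervalIntegrable (by fun_prop) _ _), mul_zero, sub_zero]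
    have integral_wu := integral_mul_le_mul_integral_of_ae_le hr.1
      (S.potential.intervalIntegrable 0 r) (hF.mul continuous_id)
      (fun s hs => mul_nonneg (S.sol_nonneg s hs.1) hs.1) hw
    simp only [Pi.mul_apply, id] at integral_wu
    rw [(S.isRadialSolutionOn r).add_mul_deriv_eq hr.1 le_rfl, intervalIntegral.integral_add
      (Continuous.intervalIntegrable (by fun_prop) _ _)
      (Continuous.intervalIntegrable (by fun_prop) _ _), integral_u',
      intervalIntegral.integral_const_mul]
    linarith
  have gronwall := le_mul_exp_of_le_add_integral hκ hR.le (by fun_prop) integral_le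
  have one_eq : F R + R * deriv F R = 1 := by
    rw [S.eq_one_sub_div le_rfl, radialFlux]
    field_simp
    ring
  have := mul_nonneg hκ (mul_nonneg (S.sol_nonneg R hR.le) hR.le)
  rw [Real.exp_neg, inv_le_iff_one_le_mul₀ (Real.exp_pos _)]
  linarith

lemma pos (S : IsRadialScattering w F R) (hr : 0 ≤ r) : 0 < F r := by
  obtain ⟨B, hB⟩ := S.potential.bdd
  have hB0 : 0 ≤ B := (S.potential.nonneg 0).trans (hB 0)
  have h := S.exp_neg_le (Real.sqrt_nonneg B)
    (Eventually.of_forall fun s _ => (hB s).trans_eq (Real.sq_sqrt hB0).symm)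
  exact (Real.exp_pos _).trans_le (h.trans (S.monotoneOn Set.self_mem_Ici hr hr))

lemma flux_le_of_ae_le (S : IsRadialScattering w F R) {K : ℝ} (hK : 0 ≤ K)
    (hw : ∀ᵐ s, 0 < s → w s ≤ K) (hr : 0 ≤ r) : radialFlux F r ≤ K * (F r * (r ^ 3 / 3)) := by
  have hc : Continuous fun s => F s * s ^ 2 := S.contDiff.continuous.mul (continuous_pow 2)
  calc radialFlux F r ≤ K * ∫ s in (0 : ℝ)..r, F s * s ^ 2 := by
        rw [S.flux_eq r hr]
        exact integral_mul_le_mul_integral_of_ae_le hr (S.potential.intervalIntegrable 0 r) hc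
          (fun s hs => mul_nonneg (S.sol_nonneg s hs.1) (sq_nonneg s)) hw
    _ ≤ K * ∫ s in (0 : ℝ)..r, F r * s ^ 2 := by
        refine mul_le_mul_of_nonneg_left ?_ hK
        refine intervalIntegral.integral_mono_on hr (hc.intervalIntegrable _ _)
          (Continuous.intervalIntegrable (by fun_prop) _ _) fun s hs => ?_
        exact mul_le_mul_of_nonneg_right (S.monotoneOn hs.1 hr hs.2) (sq_nonneg s)
    _ = K * (F r * (r ^ 3 / 3)) := by
        rw [intervalIntegral.integral_const_mul, integral_pow]
        norm_num

lemma deriv_le_of_ae_le (S : IsRadialScattering w F R) {K : ℝ} (hK : 0 ≤ K)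
    (hw : ∀ᵐ s, 0 < s → w s ≤ K) (hr : 0 < r) :
    deriv F r ≤ K * (R - radialFlux F R) / 3 := by
  have hR := S.radius_pos
  have hFR : F R * R = R - radialFlux F R := by
    rw [S.eq_one_sub_div le_rfl]
    field_simp
  have mul_le : F (min r R) * min r R ≤ F R * R := by
    have := S.pos hR.le
    have := lt_min hr hR
    gcongr
    exacts [S.monotoneOn this.le hR.le (min_le_right r R), min_le_right r R]
  rw [← hFR]
  refine le_of_mul_le_mul_left (a := r ^ 2) ?_ (by positivity)
  calc radialFlux F r ≤ radialFlux F (min r R) := by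
        rcases le_total r R with h | h
        · rw [min_eq_left h]
        · rw [min_eq_right h, S.flux_eq_of_le h]
    _ ≤ K * (F (min r R) * (min r R ^ 3 / 3)) := S.flux_le_of_ae_le hK hw (le_min hr.le hR.le)
    _ = min r R ^ 2 * (K * (F (min r R) * min r R) / 3) := by ring
    _ ≤ r ^ 2 * (K * (F R * R) / 3) := by
        have := S.pos (le_min hr.le hR.le)
        gcongr
        exact min_le_left r R

end IsRadialScattering

/-! ### The radial Neumann ground state -/

/-- `G` is the radial profile on `[0, L]` of the positive Neumann ground state for the potential
`w`, with energy `e`. -/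
structure IsRadialNeumann (w G : ℝ → ℝ) (e L : ℝ) : Prop
    extends IsRadialSolutionOn (fun s => w s - e) G L where
  energy_nonneg : 0 ≤ e
  pos : ∀ r, 0 ≤ r → r ≤ L → 0 < G r
  eq_one : G L = 1
  deriv_eq_zero : deriv G L = 0

namespace IsRadialNeumann

variable {w F G : ℝ → ℝ} {R r e L : ℝ}

lemma differentiable (N : IsRadialNeumann w G e L) : Differentiable ℝ G :=
  N.contDiff.differentiable one_ne_zero

lemma flux_mul_sub_flux_mul (N : IsRadialNeumann w G e L) (S : IsRadialScattering w F R)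
    (hr : 0 ≤ r) (hrL : r ≤ L) :
    radialFlux G r * F r - radialFlux F r * G r =
      -(e * ∫ s in (0 : ℝ)..r, G s * F s * s ^ 2) := by
  rw [(S.isRadialSolutionOn L).wronskian N.toIsRadialSolutionOn hr hrL,
    ← intervalIntegral.integral_const_mul, ← intervalIntegral.integral_neg]
  exact intervalIntegral.integral_congr fun s _ => by ring

lemma energy_mul_integral_nonneg (N : IsRadialNeumann w G e L) (S : IsRadialScattering w F R)
    (hr : 0 ≤ r) (hrL : r ≤ L) : 0 ≤ e * ∫ s in (0 : ℝ)..r, G s * F s * s ^ 2 := by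
  refine mul_nonneg N.energy_nonneg (intervalIntegral.integral_nonneg hr fun t ht => ?_)
  have := N.pos t ht.1 (ht.2.trans hrL)
  have := S.pos ht.1
  positivity

lemma hasDerivAt_div (N : IsRadialNeumann w G e L) (S : IsRadialScattering w F R)
    (hr : 0 < r) (hrL : r ≤ L) : HasDerivAt (fun r => G r / F r)
      (-(e * ∫ s in (0 : ℝ)..r, G s * F s * s ^ 2) / (r ^ 2 * F r ^ 2)) r := by
  have hF := (S.pos hr.le).ne'
  refine ((N.differentiable r).hasDerivAt.div (S.differentiable r).hasDerivAt hF).congr_deriv ?_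
  rw [← N.flux_mul_sub_flux_mul S hr.le hrL, radialFlux, radialFlux]
  field_simp

lemma continuousOn_div (N : IsRadialNeumann w G e L) (S : IsRadialScattering w F R) :
    ContinuousOn (fun r => G r / F r) (Set.Icc 0 L) :=
  N.contDiff.continuous.continuousOn.div S.contDiff.continuous.continuousOn
    fun _ hr => (S.pos hr.1).ne'

lemma antitoneOn_div (N : IsRadialNeumann w G e L) (S : IsRadialScattering w F R) :
    AntitoneOn (fun r => G r / F r) (Set.Icc 0 L) := by
  refine antitoneOn_of_hasDerivWithinAt_nonpos (convex_Icc 0 L) (N.continuousOn_div S)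
    (f' := fun r => -(e * ∫ s in (0 : ℝ)..r, G s * F s * s ^ 2) / (r ^ 2 * F r ^ 2))
    (fun r hr => ?_) fun r hr => ?_ <;> rw [interior_Icc] at hr
  · exact (N.hasDerivAt_div S hr.1 hr.2.le).hasDerivWithinAt
  · exact div_nonpos_of_nonpos_of_nonneg
      (neg_nonpos.2 (N.energy_mul_integral_nonneg S hr.1.le hr.2.le)) (by positivity)

lemma ratio_pos (N : IsRadialNeumann w G e L) (S : IsRadialScattering w F R) (hL : 0 ≤ L) :
    0 < G 0 / F 0 :=
  div_pos (N.pos 0 le_rfl hL) (S.pos le_rfl)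

lemma le_ratio_mul (N : IsRadialNeumann w G e L) (S : IsRadialScattering w F R)
    (hr : 0 ≤ r) (hrL : r ≤ L) : G r ≤ G 0 / F 0 * F r :=
  (div_le_iff₀ (S.pos hr)).1
    (N.antitoneOn_div S (Set.left_mem_Icc.2 (hr.trans hrL)) ⟨hr, hrL⟩ hr)

lemma scattering_le (N : IsRadialNeumann w G e L) (S : IsRadialScattering w F R)
    (hr : 0 ≤ r) (hrL : r ≤ L) : F r ≤ G r := by
  have hL := hr.trans hrL
  rw [← one_le_div (S.pos hr)]
  calc 1 ≤ G L / F L := by rw [N.eq_one, one_le_div (S.pos hL)]; exact S.le_one hL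
    _ ≤ G r / F r := N.antitoneOn_div S ⟨hr, hrL⟩ (Set.right_mem_Icc.2 hL) hrL

lemma energy_mul_integral (N : IsRadialNeumann w G e L) (S : IsRadialScattering w F R)
    (hRL : R ≤ L) : e * ∫ s in (0 : ℝ)..L, G s * F s * s ^ 2 = radialFlux F R := by
  have h := N.flux_mul_sub_flux_mul S (S.radius_pos.le.trans hRL) le_rfl
  have flux_G : radialFlux G L = 0 := by rw [radialFlux, N.deriv_eq_zero, mul_zero]
  rw [flux_G, N.eq_one, S.flux_eq_of_le hRL] at h
  linarith

lemma sq_sub_length_le (N : IsRadialNeumann w G e L) (S : IsRadialScattering w F R)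
    (hr : radialFlux F R ≤ r) (hrL : r ≤ L) :
    (r - radialFlux F R) ^ 2 ≤ G r * F r * r ^ 2 := by
  have ha := S.length_nonneg
  rcases (ha.trans hr).eq_or_lt with rfl | hr0
  · simp [le_antisymm hr ha]
  have hF := S.one_sub_div_le hr0
  have hG := N.scattering_le S hr0.le hrL
  have h0 : 0 ≤ 1 - radialFlux F R / r := by
    rw [sub_nonneg, div_le_one hr0]
    exact hr
  calc (r - radialFlux F R) ^ 2
      = (1 - radialFlux F R / r) * (1 - radialFlux F R / r) * r ^ 2 := by field_simp
    _ ≤ G r * F r * r ^ 2 := by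
        gcongr
        exacts [h0.trans (hF.trans hG), hF.trans hG]

lemma energy_mul_cube_le (N : IsRadialNeumann w G e L) (S : IsRadialScattering w F R)
    (hRL : R ≤ L) : e * ((L - radialFlux F R) ^ 3 / 3) ≤ radialFlux F R := by
  have ha := S.length_nonneg
  have haL := S.length_le.trans hRL
  have hF := S.contDiff.continuous
  have hG := N.contDiff.continuous
  have hc : Continuous fun s => G s * F s * s ^ 2 := by fun_prop
  calc e * ((L - radialFlux F R) ^ 3 / 3)
      = e * ∫ s in radialFlux F R..L, (s - radialFlux F R) ^ 2 := by
        rw [intervalIntegral.integral_comp_sub_right (fun s => s ^ 2), integral_pow]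
        norm_num
    _ ≤ e * ∫ s in radialFlux F R..L, G s * F s * s ^ 2 := by
        refine mul_le_mul_of_nonneg_left (intervalIntegral.integral_mono_on haL
          (Continuous.intervalIntegrable (by fun_prop) _ _) (hc.intervalIntegrable _ _)
          fun s hs => N.sq_sub_length_le S hs.1 hs.2) N.energy_nonneg
    _ ≤ e * ∫ s in (0 : ℝ)..L, G s * F s * s ^ 2 := by
        rw [← intervalIntegral.integral_add_adjacent_intervals (hc.intervalIntegrable 0 _)
          (hc.intervalIntegrable _ L), mul_add]
        exact le_add_of_nonneg_left (N.energy_mul_integral_nonneg S ha haL)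
    _ = radialFlux F R := N.energy_mul_integral S hRL

lemma energy_mul_integral_le (N : IsRadialNeumann w G e L) (S : IsRadialScattering w F R)
    (hr : 0 ≤ r) (hrL : r ≤ L) :
    e * ∫ s in (0 : ℝ)..r, G s * F s * s ^ 2 ≤ e * (G 0 / F 0 * F r ^ 2 * (r ^ 3 / 3)) := by
  have hF := S.contDiff.continuous
  have hG := N.contDiff.continuous
  have hratio := N.ratio_pos S (hr.trans hrL)
  refine mul_le_mul_of_nonneg_left ?_ N.energy_nonneg
  calc ∫ s in (0 : ℝ)..r, G s * F s * s ^ 2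
      ≤ ∫ s in (0 : ℝ)..r, G 0 / F 0 * F r ^ 2 * s ^ 2 := by
        refine intervalIntegral.integral_mono_on hr
          (Continuous.intervalIntegrable (by fun_prop) _ _)
          (Continuous.intervalIntegrable (by fun_prop) _ _) fun s hs => ?_
        have hGs := N.le_ratio_mul S hs.1 (hs.2.trans hrL)
        have hFs := S.monotoneOn hs.1 hr hs.2
        have hFs0 := (S.pos hs.1).le
        calc G s * F s * s ^ 2 ≤ (G 0 / F 0 * F s) * F s * s ^ 2 := by gcongr
          _ = G 0 / F 0 * F s ^ 2 * s ^ 2 := by ring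
          _ ≤ G 0 / F 0 * F r ^ 2 * s ^ 2 := by
              have := hratio.le
              gcongr
    _ = G 0 / F 0 * F r ^ 2 * (r ^ 3 / 3) := by
        rw [intervalIntegral.integral_const_mul, integral_pow]
        norm_num

lemma monotoneOn_div_add (N : IsRadialNeumann w G e L) (S : IsRadialScattering w F R) :
    MonotoneOn (fun r => G r / F r + e / 6 * (G 0 / F 0) * r ^ 2) (Set.Icc 0 L) := by
  refine monotoneOn_of_hasDerivWithinAt_nonneg (convex_Icc 0 L)
    (f' := fun r => -(e * ∫ s in (0 : ℝ)..r, G s * F s * s ^ 2) / (r ^ 2 * F r ^ 2) +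
      e / 6 * (G 0 / F 0) * (2 * r))
    ((N.continuousOn_div S).add (Continuous.continuousOn (by fun_prop)))
    (fun r hr => ?_) fun r hr => ?_ <;> rw [interior_Icc] at hr
  · exact ((N.hasDerivAt_div S hr.1 hr.2.le).add
      (((hasDerivAt_pow 2 r).const_mul _).congr_deriv (by simp))).hasDerivWithinAt
  · have hr0 := hr.1
    have hFr := S.pos hr.1.le
    have weight : e / 6 * (G 0 / F 0) * (2 * r) =
        e * (G 0 / F 0 * F r ^ 2 * (r ^ 3 / 3)) / (r ^ 2 * F r ^ 2) := by
      field_simp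
      ring
    rw [weight, ← add_div]
    exact div_nonneg (by linarith [N.energy_mul_integral_le S hr.1.le hr.2.le]) (by positivity)

lemma ratio_mul_le (N : IsRadialNeumann w G e L) (S : IsRadialScattering w F R)
    (hL : 0 ≤ L) : G 0 / F 0 * (1 - e / 6 * L ^ 2) ≤ 1 / F L := by
  have h := N.monotoneOn_div_add S (Set.left_mem_Icc.2 hL) (Set.right_mem_Icc.2 hL) hL
  simp only [N.eq_one] at h
  linarith

lemma _root_.IsRadialScattering.length_div_le (S : IsRadialScattering w F R)
    (hRL : 100 * R ≤ L) : radialFlux F R / L ≤ 1 / 100 := by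
  have hR := S.radius_pos
  rw [div_le_iff₀ (by linarith)]
  linarith [S.length_le]

lemma energy_le (N : IsRadialNeumann w G e L) (S : IsRadialScattering w F R)
    (hRL : 100 * R ≤ L) :
    e ≤ 3 * radialFlux F R / L ^ 3 * (1 + 4 * (radialFlux F R / L)) := by
  have hR := S.radius_pos
  have hL : 0 < L := by linarith
  have ha := S.length_nonneg
  have he := N.energy_nonneg
  have cube_le := N.energy_mul_cube_le S (by linarith)
  have ht := S.length_div_le hRL
  have ht0 : 0 ≤ radialFlux F R / L := by positivity
  have cube_eq : (L - radialFlux F R) ^ 3 = (1 - radialFlux F R / L) ^ 3 * L ^ 3 := by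
    field_simp
  rw [cube_eq] at cube_le
  set a := radialFlux F R
  set t := a / L
  have one_le : 1 ≤ (1 - t) ^ 3 * (1 + 4 * t) := by
    nlinarith [pow_nonneg ht0 3, pow_nonneg ht0 2]
  rw [div_mul_eq_mul_div, le_div_iff₀ (by positivity)]
  calc e * L ^ 3 ≤ e * L ^ 3 * ((1 - t) ^ 3 * (1 + 4 * t)) :=
        le_mul_of_one_le_right (by positivity) one_le
    _ = 3 * (e * ((1 - t) ^ 3 * L ^ 3 / 3)) * (1 + 4 * t) := by ring
    _ ≤ 3 * a * (1 + 4 * t) := by gcongr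

lemma ratio_le (N : IsRadialNeumann w G e L) (S : IsRadialScattering w F R)
    (hRL : 100 * R ≤ L) : G 0 / F 0 ≤ 1 + 2 * (radialFlux F R / L) := by
  have hR := S.radius_pos
  have hL : 0 < L := by linarith
  have ratio_mul := N.ratio_mul_le S hL.le
  rw [S.eq_one_sub_div (show R ≤ L by linarith)] at ratio_mul
  have energy := N.energy_le S hRL
  have hratio := N.ratio_pos S hL.le
  have ha := S.length_nonneg
  have ht := S.length_div_le hRL
  have ht0 : 0 ≤ radialFlux F R / L := by positivity
  have energy_mul : e / 6 * L ^ 2 ≤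
      radialFlux F R / L / 2 * (1 + 4 * (radialFlux F R / L)) := by
    calc e / 6 * L ^ 2
        ≤ (3 * radialFlux F R / L ^ 3 * (1 + 4 * (radialFlux F R / L))) / 6 * L ^ 2 := by gcongr
      _ = _ := by field_simp; ring
  set t := radialFlux F R / L
  set g := G 0 / F 0
  have one_le : 1 ≤ (1 - t / 2 * (1 + 4 * t)) * ((1 - t) * (1 + 2 * t)) := by
    nlinarith [pow_nonneg ht0 3, pow_nonneg ht0 2, pow_nonneg ht0 4]
  have h1t : 0 ≤ (1 - t) * (1 + 2 * t) := mul_nonneg (by linarith) (by linarith)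
  calc g ≤ g * ((1 - t / 2 * (1 + 4 * t)) * ((1 - t) * (1 + 2 * t))) :=
        le_mul_of_one_le_right hratio.le one_le
    _ ≤ g * ((1 - e / 6 * L ^ 2) * ((1 - t) * (1 + 2 * t))) := by gcongr
    _ = g * (1 - e / 6 * L ^ 2) * ((1 - t) * (1 + 2 * t)) := by ring
    _ ≤ 1 / (1 - t) * ((1 - t) * (1 + 2 * t)) := by gcongr
    _ = 1 + 2 * t := by
        have : 1 - t ≠ 0 := by linarith
        field_simp

lemma deriv_nonneg (N : IsRadialNeumann w G e L) (S : IsRadialScattering w F R)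
    (hr : R ≤ r) (hrL : r ≤ L) : 0 ≤ deriv G r := by
  have hr0 : 0 < r := S.radius_pos.trans_le hr
  have flux_sub := N.flux_sub hr0.le hrL le_rfl
  have integral_nonpos : ∫ s in r..L, (w s - e) * (G s * s ^ 2) ≤ 0 := by
    rw [intervalIntegral.integral_of_le hrL]
    refine setIntegral_nonpos measurableSet_Ioc fun s hs => ?_
    rw [S.eq_zero s (hr.trans_lt hs.1), zero_sub, neg_mul, neg_nonpos]
    have := N.pos s (hr0.trans hs.1).le hs.2
    have := N.energy_nonneg
    positivity
  rw [radialFlux, N.deriv_eq_zero, radialFlux] at flux_sub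
  exact nonneg_of_mul_nonneg_right (by linarith : 0 ≤ r ^ 2 * deriv G r) (by positivity)

lemma le_one (N : IsRadialNeumann w G e L) (S : IsRadialScattering w F R)
    (hRL : 100 * R ≤ L) (hr : 0 ≤ r) (hrL : r ≤ L) : G r ≤ 1 := by
  have hR := S.radius_pos
  have : 0 < L := by linarith
  rcases le_total R r with h | h
  · have monotone : MonotoneOn G (Set.Icc R L) :=
      monotoneOn_of_deriv_nonneg (convex_Icc R L) N.contDiff.continuous.continuousOn
        N.differentiable.differentiableOn fun s hs =>
          N.deriv_nonneg S (interior_subset hs).1 (interior_subset hs).2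
    rw [← N.eq_one]
    exact monotone ⟨h, hrL⟩ ⟨by linarith, le_rfl⟩ hrL
  · have hF := S.pos hr
    have hFR := S.monotoneOn hr hR.le h
    rw [S.eq_one_sub_div le_rfl] at hFR
    have ha := S.length_nonneg
    have length_div_le : radialFlux F R / L ≤ radialFlux F R / R / 100 := by
      rw [div_div]
      gcongr
      linarith
    have length_div_nonneg : 0 ≤ radialFlux F R / R := by positivity
    calc G r ≤ (1 + 2 * (radialFlux F R / L)) * F r :=
          (N.le_ratio_mul S hr hrL).trans (by gcongr; exact N.ratio_le S hRL)
      _ ≤ (1 + 2 * (radialFlux F R / R / 100)) * (1 - radialFlux F R / R) := by gcongr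
      _ ≤ 1 := by nlinarith [mul_nonneg length_div_nonneg length_div_nonneg]

lemma abs_sub_le (N : IsRadialNeumann w G e L) (S : IsRadialScattering w F R)
    (hRL : 100 * R ≤ L) (hr : 0 ≤ r) (hrL : r ≤ L) :
    |F r - G r| ≤ 2 * (radialFlux F R / L) * F r := by
  have hF := S.pos hr
  rw [abs_sub_comm, abs_of_nonneg (sub_nonneg.2 (N.scattering_le S hr hrL)), sub_le_iff_le_add]
  calc G r ≤ G 0 / F 0 * F r := N.le_ratio_mul S hr hrL
    _ ≤ (1 + 2 * (radialFlux F R / L)) * F r := by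
        gcongr
        exact N.ratio_le S hRL
    _ = _ := by ring

lemma deriv_le (N : IsRadialNeumann w G e L) (S : IsRadialScattering w F R)
    (hRL : 100 * R ≤ L) (hr : 0 < r) (hrL : r ≤ L) :
    deriv G r ≤ (1 + 2 * (radialFlux F R / L)) * deriv F r := by
  have hF := S.pos hr.le
  have hF' := S.deriv_nonneg hr
  have hflux : r ^ 2 * (deriv G r * F r) ≤ r ^ 2 * (deriv F r * G r) := by
    have := N.flux_mul_sub_flux_mul S hr.le hrL
    have := N.energy_mul_integral_nonneg S hr.le hrL
    simp only [radialFlux] at *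
    linarith
  refine le_of_mul_le_mul_right ?_ hF
  calc deriv G r * F r ≤ deriv F r * G r := le_of_mul_le_mul_left hflux (by positivity)
    _ ≤ deriv F r * ((1 + 2 * (radialFlux F R / L)) * F r) := by
        gcongr
        exact (N.le_ratio_mul S hr.le hrL).trans (by gcongr; exact N.ratio_le S hRL)
    _ = (1 + 2 * (radialFlux F R / L)) * deriv F r * F r := by ring

lemma neg_flux_le (N : IsRadialNeumann w G e L) (S : IsRadialScattering w F R)
    (hRL : 100 * R ≤ L) (hr : 0 ≤ r) (hrL : r ≤ L) : -radialFlux G r ≤ e * (r ^ 3 / 3) := by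
  have hc : Continuous fun s => G s * s ^ 2 := N.contDiff.continuous.mul (continuous_pow 2)
  rw [N.flux_eq r hr hrL, ← intervalIntegral.integral_neg]
  calc ∫ s in (0 : ℝ)..r, -((w s - e) * (G s * s ^ 2)) ≤ ∫ s in (0 : ℝ)..r, e * s ^ 2 := by
        refine intervalIntegral.integral_mono_on hr (N.intervalIntegrable_mul le_rfl hr hrL hc).neg
          (Continuous.intervalIntegrable (by fun_prop) _ _) fun s hs => ?_
        have hG1 := N.le_one S hRL hs.1 (hs.2.trans hrL)
        have hG0 := N.pos s hs.1 (hs.2.trans hrL)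
        have hw := S.potential.nonneg s
        have he := N.energy_nonneg
        calc -((w s - e) * (G s * s ^ 2)) = e * (G s * s ^ 2) - w s * (G s * s ^ 2) := by ring
          _ ≤ e * (G s * s ^ 2) := sub_le_self _ (by positivity)
          _ ≤ e * (1 * s ^ 2) := by gcongr
          _ = e * s ^ 2 := by rw [one_mul]
    _ = e * (r ^ 3 / 3) := by
        rw [intervalIntegral.integral_const_mul, integral_pow]
        norm_num

lemma neg_deriv_le (N : IsRadialNeumann w G e L) (S : IsRadialScattering w F R)
    (hRL : 100 * R ≤ L) (hr : 0 < r) (hrL : r ≤ L) :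
    -deriv G r ≤ 2 * radialFlux F R * r / L ^ 3 := by
  have hL := hr.trans_le hrL
  have ha := S.length_nonneg
  have ht := S.length_div_le hRL
  refine le_of_mul_le_mul_left (a := r ^ 2) ?_ (by positivity)
  calc r ^ 2 * -deriv G r = -radialFlux G r := by rw [radialFlux, mul_neg]
    _ ≤ e * (r ^ 3 / 3) := N.neg_flux_le S hRL hr.le hrL
    _ ≤ (3 * radialFlux F R / L ^ 3 * (1 + 4 * (radialFlux F R / L))) * (r ^ 3 / 3) := by
        gcongr
        exact N.energy_le S hRL
    _ ≤ (3 * radialFlux F R / L ^ 3 * 2) * (r ^ 3 / 3) := by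
        gcongr
        linarith
    _ = r ^ 2 * (2 * radialFlux F R * r / L ^ 3) := by ring

lemma abs_deriv_le_div_sq (N : IsRadialNeumann w G e L) (S : IsRadialScattering w F R)
    (hRL : 100 * R ≤ L) (hr : 0 < r) (hrL : r ≤ L) :
    |deriv G r| ≤ radialFlux F R * (1 + 2 * (R / L)) / r ^ 2 := by
  have hR := S.radius_pos
  have hL := hr.trans_le hrL
  have ha := S.length_nonneg
  rw [abs_le', le_div_iff₀ (by positivity), le_div_iff₀ (by positivity)]
  constructor
  · calc deriv G r * r ^ 2 ≤ ((1 + 2 * (radialFlux F R / L)) * deriv F r) * r ^ 2 := by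
          gcongr
          exact N.deriv_le S hRL hr hrL
      _ = (1 + 2 * (radialFlux F R / L)) * radialFlux F r := by rw [radialFlux, radialFlux]; ring
      _ ≤ (1 + 2 * (R / L)) * radialFlux F R := by
          have := S.flux_nonneg hr.le
          gcongr
          exacts [S.length_le, S.flux_le hr.le]
      _ = radialFlux F R * (1 + 2 * (R / L)) := by ring
  · rcases le_total R r with h | h
    · calc -deriv G r * r ^ 2 ≤ 0 :=
            mul_nonpos_of_nonpos_of_nonneg (neg_nonpos.2 (N.deriv_nonneg S h hrL)) (sq_nonneg r)
        _ ≤ radialFlux F R * (1 + 2 * (R / L)) := by positivity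
    · calc -deriv G r * r ^ 2 ≤ (2 * radialFlux F R * r / L ^ 3) * r ^ 2 := by
            gcongr
            exact N.neg_deriv_le S hRL hr hrL
        _ = radialFlux F R * (2 * (r / L) ^ 3) := by ring
        _ ≤ radialFlux F R * (2 * (r / L)) := by
            gcongr
            exact pow_le_of_le_one (by positivity) ((div_le_one hL).2 hrL) three_ne_zero
        _ ≤ radialFlux F R * (1 + 2 * (R / L)) := by
            gcongr
            exact le_add_of_nonneg_of_le zero_le_one (by gcongr)

lemma deriv_le_two_mul (N : IsRadialNeumann w G e L) (S : IsRadialScattering w F R)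
    (hRL : 100 * R ≤ L) (hr : 0 < r) (hrL : r ≤ L) : deriv G r ≤ 2 * deriv F r := by
  have hF' := S.deriv_nonneg hr
  refine (N.deriv_le S hRL hr hrL).trans ?_
  gcongr
  linarith [S.length_div_le hRL]

lemma abs_deriv_le_div (N : IsRadialNeumann w G e L) (S : IsRadialScattering w F R)
    (hRL : 100 * R ≤ L) (hr : 0 < r) (hrL : r ≤ L) : |deriv G r| ≤ 2 / r := by
  have hR := S.radius_pos
  have hL := hr.trans_le hrL
  have := S.length_nonneg
  have haL : radialFlux F R ≤ L := by linarith [S.length_le]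
  rw [abs_le', le_div_iff₀ hr, le_div_iff₀ hr]
  constructor
  · linarith [mul_le_mul_of_nonneg_right (N.deriv_le_two_mul S hRL hr hrL) hr.le,
      S.mul_deriv_le hr]
  · calc -deriv G r * r ≤ (2 * radialFlux F R * r / L ^ 3) * r := by
          gcongr
          exact N.neg_deriv_le S hRL hr hrL
      _ ≤ (2 * L * L / L ^ 3) * L := by gcongr
      _ = 2 := by field_simp

lemma abs_deriv_le_of_ae_le (N : IsRadialNeumann w G e L) (S : IsRadialScattering w F R)
    {R₀ K : ℝ} (hR₀ : R ≤ R₀) (hRL : 100 * R₀ ≤ L) (hK : 0 ≤ K)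
    (hw : ∀ᵐ s, 0 < s → w s ≤ K) (hr : 0 < r) (hrL : r ≤ L) :
    |deriv G r| ≤ 4 / (r ^ 2 + R₀ ^ 2) *
      (radialFlux F R + (R - radialFlux F R) * (K * R₀ ^ 2)) := by
  have hR := S.radius_pos
  have hR₀0 : 0 < R₀ := hR.trans_le hR₀
  have hL := hr.trans_le hrL
  have hRL' : 100 * R ≤ L := by linarith
  have ha := S.length_nonneg
  have hRa := sub_nonneg.2 S.length_le
  have hrest : 0 ≤ (R - radialFlux F R) * (K * R₀ ^ 2) := by positivity
  rw [div_mul_eq_mul_div, abs_le', le_div_iff₀ (by positivity), le_div_iff₀ (by positivity)]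
  constructor
  · have hF' := S.deriv_nonneg hr
    have upper := N.deriv_le_two_mul S hRL' hr hrL
    rcases le_total R₀ r with h | h
    · calc deriv G r * (r ^ 2 + R₀ ^ 2) ≤ (2 * deriv F r) * (r ^ 2 + r ^ 2) := by gcongr
        _ = 4 * radialFlux F r := by rw [radialFlux]; ring
        _ ≤ 4 * (radialFlux F R + (R - radialFlux F R) * (K * R₀ ^ 2)) := by
            linarith [S.flux_le hr.le]
    · calc deriv G r * (r ^ 2 + R₀ ^ 2)
          ≤ (2 * (K * (R - radialFlux F R) / 3)) * (R₀ ^ 2 + R₀ ^ 2) := by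
            gcongr
            exact upper.trans (by gcongr; exact S.deriv_le_of_ae_le hK hw hr)
        _ = 4 / 3 * ((R - radialFlux F R) * (K * R₀ ^ 2)) := by ring
        _ ≤ 4 * (radialFlux F R + (R - radialFlux F R) * (K * R₀ ^ 2)) := by linarith
  · calc -deriv G r * (r ^ 2 + R₀ ^ 2)
        ≤ (2 * radialFlux F R * r / L ^ 3) * (r ^ 2 + R₀ ^ 2) := by
          gcongr
          exact N.neg_deriv_le S hRL' hr hrL
      _ ≤ (2 * radialFlux F R * L / L ^ 3) * (L ^ 2 + L ^ 2) := by
          gcongr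
          linarith
      _ = 4 * radialFlux F R := by field_simp; ring
      _ ≤ 4 * (radialFlux F R + (R - radialFlux F R) * (K * R₀ ^ 2)) := by linarith

end IsRadialNeumann

/-! ### Gradients and linear isometries -/

section Gradient

variable {E F : Type*} [NormedAddCommGroup E] [InnerProductSpace ℝ E] [CompleteSpace E]
  [NormedAddCommGroup F] [InnerProductSpace ℝ F] [CompleteSpace F] {f g : E → ℝ} {x : E}

lemma norm_gradient (f : E → ℝ) (x : E) : ‖∇ f x‖ = ‖fderiv ℝ f x‖ :=
  (InnerProductSpace.toDual ℝ E).symm.norm_map _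

lemma continuous_gradient (hf : ContDiff ℝ 1 f) : Continuous (∇ f) :=
  (InnerProductSpace.toDual ℝ E).symm.continuous.comp (hf.continuous_fderiv one_ne_zero)

lemma hasCompactSupport_gradient (hf : HasCompactSupport f) : HasCompactSupport (∇ f) :=
  (hf.fderiv (𝕜 := ℝ)).comp_left (g := (InnerProductSpace.toDual ℝ E).symm) (map_zero _)

lemma gradient_fun_sub (hf : DifferentiableAt ℝ f x) (hg : DifferentiableAt ℝ g x) :
    ∇ (fun y => f y - g y) x = ∇ f x - ∇ g x := by
  simp only [gradient, fderiv_fun_sub hf hg, map_sub]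

lemma gradient_fun_mul (hf : DifferentiableAt ℝ f x) (hg : DifferentiableAt ℝ g x) :
    ∇ (fun y => f y * g y) x = f x • ∇ g x + g x • ∇ f x := by
  simp [gradient, fderiv_fun_mul hf hg]

lemma gradient_comp_of_hasDerivAt {h : ℝ → ℝ} {h' : ℝ} (hh : HasDerivAt h h' (f x))
    (hf : DifferentiableAt ℝ f x) : ∇ (fun y => h (f y)) x = h' • ∇ f x := by
  have hcomp : fderiv ℝ (fun y => h (f y)) x = h' • fderiv ℝ f x :=
    (hh.comp_hasFDerivAt x hf.hasFDerivAt).fderiv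
  simp [gradient, hcomp]

lemma picone_identity (hf : DifferentiableAt ℝ f x) (hg : DifferentiableAt ℝ g x) :
    ‖∇ (fun y => f y * g y) x‖ ^ 2 - inner ℝ (∇ f x) (∇ (fun y => f y * g y ^ 2) x) =
      f x ^ 2 * ‖∇ g x‖ ^ 2 := by
  rw [gradient_fun_mul hf hg, gradient_fun_mul hf (hg.fun_pow 2),
    gradient_comp_of_hasDerivAt (hasDerivAt_pow 2 (g x)) hg]
  simp only [← real_inner_self_eq_norm_sq, inner_add_left, inner_add_right, real_inner_smul_left,
    inner_smul_right, real_inner_comm (∇ g x) (∇ f x)]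
  norm_num
  ring

lemma gradient_comp_isometry {f : F → ℝ} (T : E ≃ₗᵢ[ℝ] F) (hf : DifferentiableAt ℝ f (T x)) :
    ∇ (fun y => f (T y)) x = T.symm (∇ f (T x)) := by
  have hcomp : HasFDerivAt (fun y => f (T y)) ((fderiv ℝ f (T x)).comp (T : E →L[ℝ] F)) x :=
    hf.hasFDerivAt.comp x T.toContinuousLinearEquiv.hasFDerivAt
  refine ext_inner_right ℝ fun y => ?_
  rw [inner_gradient_left, hcomp.fderiv, ← T.inner_map_map, T.apply_symm_apply,
    inner_gradient_left]
  rfl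

lemma inner_gradient_comp_isometry {f : F → ℝ} (hf : Differentiable ℝ f)
    (hg : Differentiable ℝ g) (T : E ≃ₗᵢ[ℝ] F) (x : E) :
    inner ℝ (∇ (fun y => f (T y)) x) (∇ g x) =
      inner ℝ (∇ f (T x)) (∇ (fun y => g (T.symm y)) (T x)) := by
  rw [gradient_comp_isometry T (hf _), gradient_comp_isometry T.symm (hg _), ← T.inner_map_map]
  simp

end Gradient

lemma exists_isometry_of_norm_eq {E : Type*} [NormedAddCommGroup E] [InnerProductSpace ℝ E]
    {x y : E} (h : ‖x‖ = ‖y‖) : ∃ T : E ≃ₗᵢ[ℝ] E, T x = y :=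
  ⟨_, Submodule.reflection_sub h⟩

/-! ### The weak maximum principle -/

lemma hasDerivAt_max_zero_sq (t : ℝ) : HasDerivAt (fun t : ℝ => max t 0 ^ 2) (2 * max t 0) t := by
  rcases lt_trichotomy t 0 with ht | rfl | ht
  · rw [max_eq_right ht.le, mul_zero]
    refine (hasDerivAt_const t (0 : ℝ)).congr_of_eventuallyEq ?_
    filter_upwards [Iio_mem_nhds ht] with s hs
    rw [max_eq_right (Set.mem_Iio.1 hs).le, zero_pow two_ne_zero]
  · have quadratic : (fun t : ℝ => max t 0 ^ 2) =O[𝓝 0] fun t => ‖t - 0‖ ^ 2 := by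
      refine Asymptotics.isBigO_of_le _ fun t => ?_
      rw [norm_pow, norm_pow, norm_norm, sub_zero, Real.norm_of_nonneg (le_max_right t 0)]
      gcongr
      exact max_le (le_abs_self t) (abs_nonneg t)
    simpa using (quadratic.hasFDerivAt (𝕜 := ℝ) one_lt_two).hasDerivAt
  · rw [max_eq_left ht.le]
    refine (by simpa using hasDerivAt_pow 2 t : HasDerivAt (fun t : ℝ => t ^ 2) (2 * t) t)
      |>.congr_of_eventuallyEq ?_
    filter_upwards [Ioi_mem_nhds ht] with s hs
    rw [max_eq_left (Set.mem_Ioi.1 hs).le]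

lemma contDiff_max_zero_sq : ContDiff ℝ 1 (fun t : ℝ => max t 0 ^ 2) := by
  rw [contDiff_one_iff_deriv]
  refine ⟨fun t => (hasDerivAt_max_zero_sq t).differentiableAt, ?_⟩
  rw [funext fun t => (hasDerivAt_max_zero_sq t).deriv]
  fun_prop

lemma IsBoundedPotential.integrable_mul {X : Type*} [MeasurableSpace X] {ν : Measure X}
    {v h : X → ℝ} (V : IsBoundedPotential v) (hh : Integrable h ν) :
    Integrable (fun x => v x * h x) ν := by
  obtain ⟨B, hB⟩ := V.bdd
  refine hh.bdd_mul V.measurable.aestronglyMeasurable (Eventually.of_forall fun x => ?_) (c := B)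
  rw [Real.norm_of_nonneg (V.nonneg x)]
  exact hB x

lemma IsBoundedPotential.integrable_mul_mul {X : Type*} [TopologicalSpace X] [MeasurableSpace X]
    [OpensMeasurableSpace X] {ν : Measure X} [IsFiniteMeasureOnCompacts ν] {v f φ : X → ℝ}
    (V : IsBoundedPotential v) (hf : Continuous f) (hφ : Continuous φ)
    (hc : HasCompactSupport φ) : Integrable (fun x => v x * f x * φ x) ν := by
  simp_rw [mul_assoc]
  exact V.integrable_mul ((hf.mul hφ).integrable_of_hasCompactSupport hc.mul_left)

section WeakSolution

variable {E : Type*} [NormedAddCommGroup E] [InnerProductSpace ℝ E] [CompleteSpace E]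
  [MeasurableSpace E] {ν : Measure E} {μ a : ℝ} {v w f φ : E → ℝ}

/-- `w` is a weak solution of `(-μ Δ + v) w = 0` on the whole space, for the measure `ν`, tested
against compactly supported `C¹` functions. -/
def IsWeakSolution (ν : Measure E) (μ : ℝ) (v w : E → ℝ) : Prop :=
  ∀ φ : E → ℝ, ContDiff ℝ 1 φ → HasCompactSupport φ →
    ∫ x, (μ * inner ℝ (∇ w x) (∇ φ x) + v x * w x * φ x) ∂ν = 0

lemma isWeakSolution_zero : IsWeakSolution ν μ v fun _ => 0 := fun φ _ _ => by
  simp [gradient_fun_const]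

variable [BorelSpace E] [IsFiniteMeasureOnCompacts ν]

lemma integrable_mul_inner_gradient (hf : ContDiff ℝ 1 f) (hφ : ContDiff ℝ 1 φ)
    (hc : HasCompactSupport φ) : Integrable (fun x => μ * inner ℝ (∇ f x) (∇ φ x)) ν := by
  have hf' := continuous_gradient hf
  have hφ' := continuous_gradient hφ
  refine (Continuous.integrable_of_hasCompactSupport (by fun_prop) ?_).const_mul μ
  refine (hasCompactSupport_gradient hc).mono fun x hx hx0 => hx ?_
  simp only [hx0, inner_zero_right]

lemma IsWeakSolution.sub (V : IsBoundedPotential v) (hf : ContDiff ℝ 1 f) (hw : ContDiff ℝ 1 w)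
    (Hf : IsWeakSolution ν μ v f) (Hw : IsWeakSolution ν μ v w) :
    IsWeakSolution ν μ v fun x => f x - w x := fun φ hφ hc => by
  have hdiff := integral_sub
    ((integrable_mul_inner_gradient (μ := μ) hf hφ hc (ν := ν)).add
      (V.integrable_mul_mul hf.continuous hφ.continuous hc))
    ((integrable_mul_inner_gradient (μ := μ) hw hφ hc (ν := ν)).add
      (V.integrable_mul_mul hw.continuous hφ.continuous hc))
  simp only [Pi.add_apply] at hdiff
  rw [Hf φ hφ hc, Hw φ hφ hc, sub_zero] at hdiff
  rw [← hdiff]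
  refine integral_congr_ae (Eventually.of_forall fun x => ?_)
  simp only [gradient_fun_sub (hf.differentiable one_ne_zero x) (hw.differentiable one_ne_zero x),
    inner_sub_left]
  ring

variable [ν.IsOpenPosMeasure]

/-- Testing the equation with `(w - a)₊²` makes both terms of the weak form nonnegative. -/
lemma IsWeakSolution.gradient_max_zero_sq_eq_zero (hμ : 0 < μ) (V : IsBoundedPotential v)
    (hw : ContDiff ℝ 1 w) (Hw : IsWeakSolution ν μ v w) (ha : 0 ≤ a)
    (hc : HasCompactSupport fun x => max (w x - a) 0 ^ 2) (x : E) :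
    ∇ (fun x => max (w x - a) 0 ^ 2) x = 0 := by
  have hφ : ContDiff ℝ 1 fun x => max (w x - a) 0 ^ 2 :=
    contDiff_max_zero_sq.comp (hw.sub contDiff_const)
  have gradient_eq (x) : ∇ (fun x => max (w x - a) 0 ^ 2) x = (2 * max (w x - a) 0) • ∇ w x := by
    have hwx := hw.differentiable one_ne_zero x
    rw [gradient_comp_of_hasDerivAt (f := fun y => w y - a) (hasDerivAt_max_zero_sq _)
        (hwx.sub_const a),
      gradient_fun_sub hwx (differentiableAt_const a), gradient_fun_const, sub_zero]
  have inner_eq (x) : inner ℝ (∇ w x) (∇ (fun x => max (w x - a) 0 ^ 2) x) =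
      2 * max (w x - a) 0 * ‖∇ w x‖ ^ 2 := by
    rw [gradient_eq, inner_smul_right, real_inner_self_eq_norm_sq]
  have energy_int := integrable_mul_inner_gradient (μ := μ) hw hφ hc (ν := ν)
  have potential_nonneg (x) : 0 ≤ v x * w x * max (w x - a) 0 ^ 2 := by
    have := V.nonneg x
    rcases le_total (w x) a with h | h
    · simp [max_eq_right (sub_nonpos.2 h)]
    · have := ha.trans h
      positivity
  have energy_nonneg (x) : 0 ≤ μ * inner ℝ (∇ w x) (∇ (fun x => max (w x - a) 0 ^ 2) x) := by
    rw [inner_eq]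
    positivity
  have energy_zero : ∫ x, μ * inner ℝ (∇ w x) (∇ (fun x => max (w x - a) 0 ^ 2) x) ∂ν = 0 := by
    have weak := Hw _ hφ hc
    rw [integral_add energy_int (V.integrable_mul_mul hw.continuous hφ.continuous hc)] at weak
    exact ((add_eq_zero_iff_of_nonneg (integral_nonneg energy_nonneg)
      (integral_nonneg potential_nonneg)).1 weak).1
  have hw' := continuous_gradient hw
  have hφ' := continuous_gradient hφ
  have pointwise := congrFun ((Continuous.ae_eq_iff_eq ν (by fun_prop) continuous_zero).1
    ((integral_eq_zero_iff_of_nonneg energy_nonneg energy_int).1 energy_zero)) x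
  rw [Pi.zero_apply, mul_eq_zero_iff_left hμ.ne', inner_eq] at pointwise
  rw [gradient_eq]
  simpa using pointwise

lemma IsWeakSolution.le_of_eventually_lt [Nontrivial E] (hμ : 0 < μ) (V : IsBoundedPotential v)
    (hw : ContDiff ℝ 1 w) (Hw : IsWeakSolution ν μ v w) (ha : 0 ≤ a)
    (hlt : ∀ᶠ x in cocompact E, w x < a) (x : E) : w x ≤ a := by
  have truncation_eq_zero {y} (hy : w y < a) : max (w y - a) 0 ^ 2 = 0 := by
    rw [max_eq_right (sub_nonpos.2 hy.le), zero_pow two_ne_zero]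
  obtain ⟨K, hK, hKw⟩ := mem_cocompact.1 hlt
  have hc : HasCompactSupport fun x => max (w x - a) 0 ^ 2 :=
    HasCompactSupport.intro hK fun x hx => truncation_eq_zero (hKw hx)
  have constant (y) : max (w x - a) 0 ^ 2 = max (w y - a) 0 ^ 2 := by
    refine is_const_of_fderiv_eq_zero (𝕜 := ℝ) (f := fun x => max (w x - a) 0 ^ 2)
      ((contDiff_max_zero_sq.comp (hw.sub contDiff_const)).differentiable one_ne_zero)
      (fun z => ?_) x y
    rw [← toDual_gradient, Hw.gradient_max_zero_sq_eq_zero hμ V hw ha hc z, map_zero]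
  have := NormedSpace.noncompactSpace ℝ E
  obtain ⟨y, hy⟩ := hlt.exists
  have hx := (constant y).trans (truncation_eq_zero hy)
  rw [sq_eq_zero_iff, max_eq_right_iff] at hx
  linarith

end WeakSolution

/-! ### Uniqueness and radial symmetry -/

/-- `f x` depends only on `‖x‖`. -/
def IsRadial {E α : Type*} [Norm E] (f : E → α) : Prop :=
  ∀ x y, ‖x‖ = ‖y‖ → f x = f y

lemma IsBoundedPotential.integrableOn_weak_form {E : Type*} [NormedAddCommGroup E]
    [InnerProductSpace ℝ E] [CompleteSpace E] [MeasurableSpace E] [BorelSpace E] {ν : Measure E}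
    [IsFiniteMeasureOnCompacts ν] {μ : ℝ} {v f φ : E → ℝ} {K : Set E} (V : IsBoundedPotential v)
    (hf : ContDiff ℝ 1 f) (hφ : ContDiff ℝ 1 φ) (hK : IsCompact K) :
    IntegrableOn (fun x => μ * inner ℝ (∇ f x) (∇ φ x) + v x * f x * φ x) K ν := by
  have hf' := continuous_gradient hf
  have hφ' := continuous_gradient hφ
  refine ((by fun_prop : Continuous fun x => μ * inner ℝ (∇ f x) (∇ φ x)).continuousOn
    |>.integrableOn_compact hK).add ?_
  simp_rw [mul_assoc]
  exact V.integrable_mul ((hf.continuous.mul hφ.continuous).continuousOn.integrableOn_compact hK)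

lemma eq_zero_of_setIntegral_closedBall_eq_zero {E : Type*} [NormedAddCommGroup E]
    [NormedSpace ℝ E] [ProperSpace E] [MeasurableSpace E] [BorelSpace E] {ν : Measure E}
    [IsFiniteMeasureOnCompacts ν] [ν.IsOpenPosMeasure] {k : E → ℝ} {c x : E} {r : ℝ} (hr : r ≠ 0)
    (hk : Continuous k) (hk₀ : ∀ x, 0 ≤ k x) (h : ∫ x in Metric.closedBall c r, k x ∂ν = 0)
    (hx : x ∈ Metric.closedBall c r) : k x = 0 := by
  have ae_closedBall := (setIntegral_eq_zero_iff_of_nonneg_ae (Eventually.of_forall hk₀)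
    (hk.continuousOn.integrableOn_compact (isCompact_closedBall c r))).1 h
  have ae_ball : k =ᵐ[ν.restrict (Metric.ball c r)] fun _ => 0 :=
    ae_restrict_of_ae_restrict_of_subset Metric.ball_subset_closedBall ae_closedBall
  have eqOn_closure := (Measure.eqOn_open_of_ae_eq ae_ball Metric.isOpen_ball hk.continuousOn
    continuousOn_const).closure hk continuous_const
  rw [closure_ball c hr] at eqOn_closure
  exact eqOn_closure hx

lemma eq_of_gradient_eq_zero {E : Type*} [NormedAddCommGroup E] [InnerProductSpace ℝ E]
    [CompleteSpace E] {f : E → ℝ} {s : Set E} {x y : E} (hs : Convex ℝ s)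
    (hf : Differentiable ℝ f) (hf' : ∀ z ∈ s, ∇ f z = 0) (hx : x ∈ s) (hy : y ∈ s) :
    f x = f y := by
  have dist_le := hs.norm_image_sub_le_of_norm_fderiv_le (𝕜 := ℝ) (f := f) (C := 0)
    (fun z _ => hf z) (fun z hz => by rw [← norm_gradient, hf' z hz, norm_zero]) hy hx
  rwa [zero_mul, norm_le_zero_iff, sub_eq_zero] at dist_le

section Symmetry

variable {μ L : ℝ} {v f g : E3 → ℝ}

lemma IsScatteringSolution.comp_isometry (hv : IsRadial v) (h : IsScatteringSolution μ v f)
    (T : E3 ≃ₗᵢ[ℝ] E3) : IsScatteringSolution μ v (fun x => f (T x)) where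
  contDiff := h.contDiff.comp T.contDiff
  equation φ hφ hφc := by
    have weak := h.equation (fun y => φ (T.symm y)) (hφ.comp T.symm.contDiff)
      (hφc.comp_homeomorph T.symm.toHomeomorph)
    rw [← T.measurePreserving.integral_comp T.toHomeomorph.measurableEmbedding] at weak
    simpa only [inner_gradient_comp_isometry (h.contDiff.differentiable one_ne_zero)
      (hφ.differentiable one_ne_zero), T.symm_apply_apply, hv _ _ (T.norm_map _)] using weak
  tendsto_one := h.tendsto_one.comp T.toHomeomorph.isClosedEmbedding.tendsto_cocompact

lemma IsScatteringSolution.le (hμ : 0 < μ) (V : IsBoundedPotential v)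
    (hf : IsScatteringSolution μ v f) (hg : IsScatteringSolution μ v g) (x : E3) : f x ≤ g x := by
  refine le_of_forall_pos_le_add fun ε hε => ?_
  have difference_tendsto : Tendsto (fun x => f x - g x) (cocompact E3) (𝓝 0) := by
    simpa using hf.tendsto_one.sub hg.tendsto_one
  have H : IsWeakSolution volume μ v fun x => f x - g x :=
    .sub V hf.contDiff hg.contDiff hf.equation hg.equation
  exact sub_le_iff_le_add'.1 (H.le_of_eventually_lt hμ V (hf.contDiff.sub hg.contDiff) hε.le
    (difference_tendsto.eventually_lt_const hε) x)

lemma IsScatteringSolution.isRadial (hμ : 0 < μ) (V : IsBoundedPotential v) (hv : IsRadial v)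
    (hf : IsScatteringSolution μ v f) : IsRadial f := fun x y h => by
  obtain ⟨T, rfl⟩ := exists_isometry_of_norm_eq h
  exact le_antisymm (hf.le hμ V (hf.comp_isometry hv T) x)
    ((hf.comp_isometry hv T).le hμ V hf x)

lemma IsScatteringSolution.nonneg (hμ : 0 < μ) (V : IsBoundedPotential v)
    (hf : IsScatteringSolution μ v f) (x : E3) : 0 ≤ f x := by
  have neg_tendsto : Tendsto (fun x => 0 - f x) (cocompact E3) (𝓝 (0 - 1)) :=
    tendsto_const_nhds.sub hf.tendsto_one
  have H : IsWeakSolution volume μ v fun x => 0 - f x :=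
    .sub V contDiff_const hf.contDiff isWeakSolution_zero hf.equation
  simpa using H.le_of_eventually_lt hμ V (contDiff_const.sub hf.contDiff) le_rfl
    (neg_tendsto.eventually_lt_const (by norm_num)) x

lemma IsNeumannGroundState.comp_isometry (hv : IsRadial v) (h : IsNeumannGroundState μ v L f)
    (T : E3 ≃ₗᵢ[ℝ] E3) : IsNeumannGroundState μ v L (fun x => f (T x)) where
  contDiff := h.contDiff.comp T.contDiff
  pos x hx := h.pos _ (by rwa [T.norm_map])
  equation φ hφ := by
    have weak := h.equation (fun y => φ (T.symm y)) (hφ.comp T.symm.contDiff)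
    have preimage_ball : T ⁻¹' Metric.closedBall 0 L = Metric.closedBall 0 L := by
      ext x
      simp
    rw [← T.measurePreserving.setIntegral_preimage_emb T.toHomeomorph.measurableEmbedding,
      ← T.measurePreserving.setIntegral_preimage_emb T.toHomeomorph.measurableEmbedding
        (fun y => f y * φ (T.symm y)), preimage_ball] at weak
    simpa only [inner_gradient_comp_isometry (h.contDiff.differentiable one_ne_zero)
      (hφ.differentiable one_ne_zero), T.symm_apply_apply, hv _ _ (T.norm_map _)] using weak
  eq_one x hx := h.eq_one _ (by rwa [T.norm_map])
  radial_deriv x hx := by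
    have chain : HasFDerivAt (fun y => f (T y))
        ((fderiv ℝ f (T x)).comp (T.toContinuousLinearEquiv : E3 →L[ℝ] E3)) x :=
      (h.contDiff.differentiable one_ne_zero (T x)).hasFDerivAt.comp x
        T.toContinuousLinearEquiv.hasFDerivAt
    rw [chain.fderiv]
    exact h.radial_deriv (T x) (by rwa [T.norm_map])

lemma IsNeumannGroundState.sol_pos (hf : IsNeumannGroundState μ v L f) (x : E3) : 0 < f x := by
  rcases le_total ‖x‖ L with hx | hx
  · exact hf.pos x hx
  · exact (hf.eq_one x hx).symm ▸ one_pos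

/-- Test the equation of `f` with `f h²` and that of `f h` with itself. -/
lemma IsNeumannGroundState.setIntegral_sq_mul_norm_gradient_sq {h : E3 → ℝ}
    (V : IsBoundedPotential v) (hf : IsNeumannGroundState μ v L f) (hh : ContDiff ℝ 1 h)
    (hfh : IsNeumannGroundState μ v L fun x => f x * h x) :
    ∫ x in Metric.closedBall 0 L, μ * (f x ^ 2 * ‖∇ h x‖ ^ 2) = 0 := by
  have hφ : ContDiff ℝ 1 fun x => f x * h x ^ 2 := hf.contDiff.mul (hh.pow 2)
  have weak_f := hf.equation _ hφ
  have weak_fh := hfh.equation _ hfh.contDiff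
  have mass_eq (x) : f x * (f x * h x ^ 2) = f x * h x * (f x * h x) := by ring
  simp only [mass_eq] at weak_f
  have hdiff := integral_sub
    (V.integrableOn_weak_form (μ := μ) hfh.contDiff hfh.contDiff (isCompact_closedBall 0 L)
      (ν := volume))
    (V.integrableOn_weak_form (μ := μ) hf.contDiff hφ (isCompact_closedBall 0 L))
  rw [weak_f, weak_fh, sub_self] at hdiff
  rw [← hdiff]
  refine integral_congr_ae (Eventually.of_forall fun x => ?_)
  simp only [← picone_identity (hf.contDiff.differentiable one_ne_zero x)
    (hh.differentiable one_ne_zero x), real_inner_self_eq_norm_sq]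
  ring

lemma IsNeumannGroundState.unique (hμ : 0 < μ) (hL : 0 < L) (V : IsBoundedPotential v)
    (hf : IsNeumannGroundState μ v L f) (hg : IsNeumannGroundState μ v L g) : f = g := by
  have hfh (x) : g x = f x * (g x / f x) := (mul_div_cancel₀ _ (hf.sol_pos x).ne').symm
  have hh : ContDiff ℝ 1 fun x => g x / f x :=
    hg.contDiff.div hf.contDiff fun x => (hf.sol_pos x).ne'
  have ratio_gradient (x) (hx : x ∈ Metric.closedBall 0 L) : ∇ (fun x => g x / f x) x = 0 := by
    have cf := hf.contDiff.continuous
    have ch := continuous_gradient hh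
    have integrand_zero := eq_zero_of_setIntegral_closedBall_eq_zero hL.ne' (by fun_prop)
      (fun x => by positivity)
      (hf.setIntegral_sq_mul_norm_gradient_sq V hh (funext hfh ▸ hg)) hx
    simpa [hμ.ne', (hf.sol_pos x).ne'] using integrand_zero
  obtain ⟨y, hy⟩ := exists_norm_eq E3 hL.le
  ext x
  rcases le_total L ‖x‖ with hx | hx
  · rw [hf.eq_one x hx, hg.eq_one x hx]
  · have ratio_const := eq_of_gradient_eq_zero (convex_closedBall 0 L)
      (hh.differentiable one_ne_zero) ratio_gradient (mem_closedBall_zero_iff.2 hx)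
      (mem_closedBall_zero_iff.2 hy.le)
    rw [hfh x, ratio_const, hf.eq_one y hy.ge, hg.eq_one y hy.ge, div_one, mul_one]

lemma IsNeumannGroundState.isRadial (hμ : 0 < μ) (hL : 0 < L) (V : IsBoundedPotential v)
    (hv : IsRadial v) (hf : IsNeumannGroundState μ v L f) : IsRadial f := fun x y h => by
  obtain ⟨T, rfl⟩ := exists_isometry_of_norm_eq h
  exact congrFun (hf.unique hμ hL V (hf.comp_isometry hv T)) x

end Symmetry

/-! ### From the weak to the integrated radial equation -/

lemma eq_zero_of_integral_sq_mul_eq_zero {G k : ℝ → ℝ} {a b r : ℝ} (hab : a < b)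
    (hG : Continuous G) (hk : Continuous k) (hpos : ∀ s ∈ Set.Ioo a b, 0 < k s)
    (h : ∫ s in a..b, G s ^ 2 * k s = 0) (hr : r ∈ Set.Icc a b) : G r = 0 := by
  have hk₀ : ∀ s ∈ Set.Icc a b, 0 ≤ k s := fun s hs => by
    rw [← closure_Ioo hab.ne] at hs
    exact closure_minimal (fun s hs => (hpos s hs).le) (isClosed_le continuous_const hk) hs
  have interior_zero : Set.EqOn G (fun _ => 0) (Set.Ioo a b) := fun s hs => by
    by_contra hne
    refine (intervalIntegral.integral_pos hab ((hG.pow 2).mul hk).continuousOn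
      (fun t ht => mul_nonneg (sq_nonneg _) (hk₀ t (Set.Ioc_subset_Icc_self ht)))
      ⟨s, Set.Ioo_subset_Icc_self hs, ?_⟩).ne' h
    exact mul_pos (sq_pos_of_ne_zero hne) (hpos s hs)
  rw [← closure_Ioo hab.ne] at hr
  exact interior_zero.closure hG continuous_const hr

/-- The derivative of `η (r ^ 2)` is made equal to `2 r (L ^ 2 - r ^ 2) G r`. -/
lemma eq_zero_of_integral_mul_deriv_comp_sq_eq_zero {G : ℝ → ℝ} {L r : ℝ} (hL : 0 < L)
    (hG : Continuous G)
    (h : ∀ η : ℝ → ℝ, ContDiff ℝ 1 η → (∀ t, L ^ 2 ≤ t → η t = 0) →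
      ∫ s in (0 : ℝ)..L, G s * deriv (fun s => η (s ^ 2)) s = 0)
    (hr : r ∈ Set.Icc 0 L) : G r = 0 := by
  set χ : ℝ → ℝ := fun t => G √t * max (L ^ 2 - t) 0 with χ_def
  have hχ : Continuous χ := (hG.comp Real.continuous_sqrt).mul (by fun_prop)
  have hη (t) : HasDerivAt (fun t => ∫ s in (L ^ 2)..t, χ s) (χ t) t :=
    hχ.integral_hasStrictDerivAt _ t |>.hasDerivAt
  have hη₁ : ContDiff ℝ 1 fun t => ∫ s in (L ^ 2)..t, χ s :=
    contDiff_one_iff_deriv.2 ⟨fun t => (hη t).differentiableAt,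
      by rwa [funext fun t => (hη t).deriv]⟩
  have weak := h _ hη₁ fun t ht => by
    rw [intervalIntegral.integral_of_le ht]
    refine setIntegral_eq_zero_of_forall_eq_zero fun s hs => ?_
    simp only [χ_def, max_eq_right (sub_nonpos.2 hs.1.le), mul_zero]
  refine eq_zero_of_integral_sq_mul_eq_zero (k := fun s => 2 * s * (L ^ 2 - s ^ 2)) hL hG
    (by fun_prop) (fun s hs => ?_) ((intervalIntegral.integral_congr fun s hs => ?_).trans weak) hr
  · have := hs.1
    have : 0 < L ^ 2 - s ^ 2 := by nlinarith [hs.1, hs.2]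
    positivity
  · rw [Set.uIcc_of_le hL.le] at hs
    have chain : HasDerivAt (fun s => ∫ t in (L ^ 2)..(s ^ 2), χ t) (χ (s ^ 2) * (2 * s)) s :=
      (HasDerivAt.comp (h₂ := fun t => ∫ x in (L ^ 2)..t, χ x) s (hη (s ^ 2))
        (hasDerivAt_pow 2 s)).congr_deriv (by simp)
    simp only [chain.deriv]
    simp only [χ_def, Real.sqrt_sq hs.1,
      max_eq_left (by nlinarith [hs.1, hs.2] : 0 ≤ L ^ 2 - s ^ 2)]
    ring

lemma eq_integral_of_forall_integral_comp_sq {p q : ℝ → ℝ} {L r : ℝ} (hL : 0 < L)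
    (hp : Continuous p) (hq : ∀ a b, IntervalIntegrable q volume a b)
    (h : ∀ η : ℝ → ℝ, ContDiff ℝ 1 η → (∀ t, L ^ 2 ≤ t → η t = 0) →
      ∫ s in (0 : ℝ)..L, (p s * deriv (fun s => η (s ^ 2)) s + q s * η (s ^ 2)) = 0)
    (hr : r ∈ Set.Icc 0 L) : p r = ∫ s in (0 : ℝ)..r, q s := by
  set H : ℝ → ℝ := fun r => ∫ s in (0 : ℝ)..r, q s with H_def
  have hH : Continuous H := intervalIntegral.continuous_primitive hq 0
  refine sub_eq_zero.1 (eq_zero_of_integral_mul_deriv_comp_sq_eq_zero (G := fun r => p r - H r) hL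
    (hp.sub hH) (fun η hη hη₀ => ?_) hr)
  have hη_sq : ContDiff ℝ 1 fun s => η (s ^ 2) := hη.comp (contDiff_id.pow 2)
  have cη := hη_sq.continuous
  have cη' := hη_sq.continuous_deriv le_rfl
  have parts := integral_mul_deriv_add_mul_of_primitive (p := H) hL.le (hq 0 L)
    hη_sq.contDiffOn.absolutelyContinuousOnInterval fun x _ => by simp [H_def]
  have H_zero : H 0 = 0 := intervalIntegral.integral_same
  rw [hη₀ _ le_rfl, H_zero, mul_zero, zero_mul, sub_zero] at parts
  have hint {f : ℝ → ℝ} (hf : Continuous f) : IntervalIntegrable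
      (fun s => f s * deriv (fun s => η (s ^ 2)) s + q s * η (s ^ 2)) volume 0 L :=
    ((hf.mul cη').intervalIntegrable 0 L).add ((hq 0 L).mul_continuousOn cη.continuousOn)
  refine Eq.trans ?_ (sub_eq_zero.2 ((h η hη hη₀).trans parts.symm))
  rw [← intervalIntegral.integral_sub (hint hp) (hint hH)]
  refine intervalIntegral.integral_congr fun s _ => ?_
  ring

/-! ### Profiles of radial functions -/

lemma isRadial_comp_norm_sq {E : Type*} [Norm E] (η : ℝ → ℝ) : IsRadial fun x : E => η (‖x‖ ^ 2) :=
  fun x y h => by simp only [h]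

lemma IsRadial.gradient_zero {E : Type*} [NormedAddCommGroup E] [InnerProductSpace ℝ E]
    [CompleteSpace E] {f : E → ℝ} (hf : IsRadial f) (hf' : Differentiable ℝ f) : ∇ f 0 = 0 := by
  have reflected := gradient_comp_isometry (x := 0) (LinearIsometryEquiv.neg ℝ) (hf' _)
  rw [funext fun x => hf (LinearIsometryEquiv.neg ℝ x) x (by simp), map_zero] at reflected
  have : IsAddTorsionFree E := .of_isTorsionFree ℝ E
  exact self_eq_neg.1 reflected

section Profile

variable {E : Type*} [NormedAddCommGroup E] [InnerProductSpace ℝ E] [Nontrivial E] {f g : E → ℝ}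

variable (E) in
/-- A unit vector of `E`; it spans the line along which profiles are taken. -/
noncomputable def unitVector : E :=
  (exists_norm_eq E zero_le_one).choose

lemma norm_unitVector : ‖unitVector E‖ = 1 :=
  (exists_norm_eq E zero_le_one).choose_spec

lemma norm_smul_unitVector (r : ℝ) : ‖r • unitVector E‖ = |r| := by
  rw [norm_smul, norm_unitVector, mul_one, Real.norm_eq_abs]

/-- The profile of a radial function `f`, that is, the function `F` with `f x = F ‖x‖`. Taking it
along a line rather than a ray makes it as smooth on `ℝ` as `f` is on `E`. -/
noncomputable def profile (f : E → ℝ) (r : ℝ) : ℝ :=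
  f (r • unitVector E)

lemma contDiff_profile (hf : ContDiff ℝ 1 f) : ContDiff ℝ 1 (profile f) :=
  hf.comp (contDiff_id.smul contDiff_const)

lemma IsRadial.profile_norm (hf : IsRadial f) (x : E) : profile f ‖x‖ = f x :=
  hf _ _ (by rw [norm_smul_unitVector, abs_norm])

lemma profile_comp_norm_sq (η : ℝ → ℝ) : profile (fun x : E => η (‖x‖ ^ 2)) = fun r => η (r ^ 2) :=
  funext fun r => by simp only [profile, norm_smul_unitVector, sq_abs]

lemma hasDerivAt_profile (hf : Differentiable ℝ f) (r : ℝ) :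
    HasDerivAt (profile f) (fderiv ℝ f (r • unitVector E) (unitVector E)) r :=
  (hf _).hasFDerivAt.comp_hasDerivAt r
    (((hasDerivAt_id r).smul_const (unitVector E)).congr_deriv (one_smul ℝ _))

lemma isBoundedPotential_profile [MeasurableSpace E] [BorelSpace E] {v : E → ℝ}
    (V : IsBoundedPotential v) : IsBoundedPotential (profile v) where
  measurable := V.measurable.comp (continuous_id.smul continuous_const).measurable
  nonneg _ := V.nonneg _
  bdd := V.bdd.imp fun _ hB _ => hB _

variable [CompleteSpace E]

lemma IsRadial.gradient_eq (hf : IsRadial f) (hf' : Differentiable ℝ f) {x : E} (hx : x ≠ 0) :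
    ∇ f x = deriv (profile f) ‖x‖ • ∇ (fun y : E => ‖y‖) x := by
  rw [← gradient_comp_of_hasDerivAt (hasDerivAt_profile hf' _).differentiableAt.hasDerivAt
    ((contDiffAt_norm ℝ hx).differentiableAt one_ne_zero), funext hf.profile_norm]

lemma IsRadial.inner_gradient (hf : IsRadial f) (hg : IsRadial g) (hf' : Differentiable ℝ f)
    (hg' : Differentiable ℝ g) (x : E) :
    inner ℝ (∇ f x) (∇ g x) = deriv (profile f) ‖x‖ * deriv (profile g) ‖x‖ := by
  rcases eq_or_ne x 0 with rfl | hx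
  · have profile_deriv : deriv (profile f) 0 = 0 := by
      rw [(hasDerivAt_profile hf' 0).deriv, zero_smul, ← inner_gradient_left,
        hf.gradient_zero hf', inner_zero_left]
    rw [hf.gradient_zero hf', norm_zero, profile_deriv, inner_zero_left, zero_mul]
  · have norm_differentiable := (contDiffAt_norm ℝ hx).differentiableAt one_ne_zero
    rw [hf.gradient_eq hf' hx, hg.gradient_eq hg' hx, real_inner_smul_left, real_inner_smul_right,
      real_inner_self_eq_norm_sq, norm_gradient, norm_fderiv_norm norm_differentiable]
    ring

lemma IsRadial.norm_gradient (hf : IsRadial f) (hf' : Differentiable ℝ f) (x : E) :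
    ‖∇ f x‖ = |deriv (profile f) ‖x‖| := by
  rw [← abs_norm, ← sq_eq_sq_iff_abs_eq_abs, ← real_inner_self_eq_norm_sq,
    hf.inner_gradient hf hf' hf', sq]

end Profile

lemma integral_comp_norm (h : ℝ → ℝ) :
    ∫ x : E3, h ‖x‖ = 4 * Real.pi * ∫ r in Set.Ioi (0 : ℝ), r ^ 2 * h r := by
  rw [integral_fun_norm_addHaar]
  simp only [finrank_euclideanSpace, Fintype.card_fin, Measure.real,
    EuclideanSpace.volume_ball_fin_three, smul_eq_mul, nsmul_eq_mul]
  rw [ENNReal.toReal_mul, ENNReal.toReal_ofReal (by positivity)]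
  norm_num
  ring

lemma setIntegral_closedBall_comp_norm {L : ℝ} (hL : 0 ≤ L) (h : ℝ → ℝ) :
    ∫ x in Metric.closedBall (0 : E3) L, h ‖x‖ =
      4 * Real.pi * ∫ r in (0 : ℝ)..L, r ^ 2 * h r := by
  have indicator_comp_norm : (Metric.closedBall (0 : E3) L).indicator (fun x => h ‖x‖) =
      fun x => (Set.Iic L).indicator h ‖x‖ := by
    ext x
    simp [Set.indicator]
  rw [← integral_indicator Metric.isClosed_closedBall.measurableSet, indicator_comp_norm,
    integral_comp_norm, intervalIntegral.integral_of_le hL, ← Set.Ioi_inter_Iic,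
    ← setIntegral_indicator measurableSet_Iic]
  simp only [Set.indicator_apply, mul_ite, mul_zero]

lemma integral_comp_norm_of_eq_zero {L : ℝ} {h : ℝ → ℝ} (hL : 0 ≤ L) (h₀ : ∀ r, L < r → h r = 0) :
    ∫ x : E3, h ‖x‖ = 4 * Real.pi * ∫ r in (0 : ℝ)..L, r ^ 2 * h r := by
  rw [← setIntegral_closedBall_comp_norm hL, setIntegral_eq_integral_of_forall_compl_eq_zero]
  exact fun x hx => h₀ _ (by simpa using hx)

/-! ### Reduction to the radial problems -/

lemma gradient_eq_zero_of_lt_norm {E : Type*} [NormedAddCommGroup E] [InnerProductSpace ℝ E]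
    [CompleteSpace E] {f : E → ℝ} {c L : ℝ} {x : E} (h : ∀ x, L ≤ ‖x‖ → f x = c) (hx : L < ‖x‖) :
    ∇ f x = 0 := by
  have eventually_const : f =ᶠ[𝓝 x] fun _ => c := by
    filter_upwards [(isOpen_lt continuous_const continuous_norm).mem_nhds hx] with y hy
    exact h y (le_of_lt hy)
  rw [eventually_const.gradient_eq, gradient_fun_const]

lemma isRadialSolutionOn_profile {μ L : ℝ} {u f : E3 → ℝ} (hμ : μ ≠ 0) (hL : 0 < L)
    (hu : IsRadial u) (hu' : ∀ a b, IntervalIntegrable (profile u) volume a b)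
    (hf : ContDiff ℝ 1 f) (hf' : IsRadial f)
    (weak : ∀ φ : E3 → ℝ, ContDiff ℝ 1 φ → (∀ x, L ≤ ‖x‖ → φ x = 0) →
      ∫ x in Metric.closedBall 0 L, (μ * inner ℝ (∇ f x) (∇ φ x) + u x * f x * φ x) = 0) :
    IsRadialSolutionOn (fun s => profile u s / μ) (profile f) L where
  intervalIntegrable := (hu' 0 L).div_const μ
  contDiff := contDiff_profile hf
  flux_eq r hr hrL := by
    have hF := contDiff_profile hf
    refine eq_integral_of_forall_integral_comp_sq hL (continuous_radialFlux hF)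
      (fun a b => ((hu' a b).div_const μ).mul_continuousOn
        (hF.continuous.mul (continuous_pow 2)).continuousOn) (fun η hη hη₀ => ?_) ⟨hr, hrL⟩
    have hφ : ContDiff ℝ 1 fun x : E3 => η (‖x‖ ^ 2) := hη.comp (contDiff_norm_sq ℝ)
    have tested := weak _ hφ fun x hx => hη₀ _ (pow_le_pow_left₀ hL.le hx 2)
    simp_rw [hf'.inner_gradient (isRadial_comp_norm_sq η) (hf.differentiable one_ne_zero)
      (hφ.differentiable one_ne_zero), profile_comp_norm_sq, ← hu.profile_norm,
      ← hf'.profile_norm] at tested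
    rw [setIntegral_closedBall_comp_norm hL.le fun r => μ * (deriv (profile f) r *
      deriv (fun r => η (r ^ 2)) r) + profile u r * profile f r * η (r ^ 2)] at tested
    have radially_tested := (mul_eq_zero.1 tested).resolve_left (by positivity)
    refine (mul_eq_zero.1 (Eq.trans ?_ radially_tested)).resolve_left hμ
    rw [← intervalIntegral.integral_const_mul]
    refine intervalIntegral.integral_congr fun s _ => ?_
    simp only [radialFlux]
    field_simp

lemma IsBoundedPotential.div_const {X : Type*} [MeasurableSpace X] {w : X → ℝ} {c : ℝ}
    (W : IsBoundedPotential w) (hc : 0 ≤ c) : IsBoundedPotential fun x => w x / c where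
  measurable := W.measurable.div_const c
  nonneg x := div_nonneg (W.nonneg x) hc
  bdd := by
    obtain ⟨B, hB⟩ := W.bdd
    exact ⟨B / c, fun x => by gcongr; exact hB x⟩

/-- A bounded, measurable, nonnegative radial potential supported in the ball of radius `R > 0`. -/
structure IsCentralPotential (v : E3 → ℝ) (R : ℝ) : Prop extends IsBoundedPotential v where
  radius_pos : 0 < R
  isRadial : IsRadial v
  eq_zero : ∀ x, R < ‖x‖ → v x = 0

section CentralPotential

variable {μ L R : ℝ} {v f : E3 → ℝ}

lemma IsCentralPotential.profile_eq_zero {r : ℝ} (V : IsCentralPotential v R) (hr : R < r) :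
    profile v r = 0 :=
  V.eq_zero _ (by rwa [norm_smul_unitVector, abs_of_pos (V.radius_pos.trans hr)])

lemma tendsto_profile {c : ℝ} (hf : Tendsto f (cocompact E3) (𝓝 c)) :
    Tendsto (profile f) atTop (𝓝 c) := by
  refine hf.comp ?_
  rw [← Metric.cobounded_eq_cocompact, ← tendsto_norm_atTop_iff_cobounded]
  simpa only [norm_smul_unitVector] using tendsto_abs_atTop_atTop

lemma IsScatteringSolution.isRadialScattering (hμ : 0 < μ) (V : IsCentralPotential v R)
    (hf : IsScatteringSolution μ v f) :
    IsRadialScattering (fun r => profile v r / μ) (profile f) R where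
  potential := (isBoundedPotential_profile V.toIsBoundedPotential).div_const hμ.le
  radius_pos := V.radius_pos
  eq_zero r hr := by rw [V.profile_eq_zero hr, zero_div]
  contDiff := contDiff_profile hf.contDiff
  sol_nonneg r _ := hf.nonneg hμ V.toIsBoundedPotential _
  tendsto_one := tendsto_profile hf.tendsto_one
  flux_eq r hr := by
    refine (isRadialSolutionOn_profile (L := r + 1) hμ.ne' (by positivity) V.isRadial
      (isBoundedPotential_profile V.toIsBoundedPotential).intervalIntegrable hf.contDiff
      (hf.isRadial hμ V.toIsBoundedPotential V.isRadial) fun φ hφ hφ₀ => ?_).flux_eq r hr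
      (by linarith)
    have vanishes {x} (hx : x ∉ Metric.closedBall 0 (r + 1)) : φ x = 0 ∧ ∇ φ x = 0 := by
      rw [mem_closedBall_zero_iff, not_le] at hx
      exact ⟨hφ₀ x hx.le, gradient_eq_zero_of_lt_norm hφ₀ hx⟩
    rw [setIntegral_eq_integral_of_forall_compl_eq_zero fun x hx => by simp [vanishes hx]]
    exact hf.equation φ hφ (.intro (isCompact_closedBall 0 (r + 1)) fun x hx => (vanishes hx).1)

lemma neumannEnergy_nonneg (hμ : 0 ≤ μ) (hv : ∀ x, 0 ≤ v x) : 0 ≤ neumannEnergy μ v L := by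
  refine Real.sInf_nonneg ?_
  rintro q ⟨φ, -, norm_pos, rfl⟩
  exact div_nonneg (integral_nonneg fun x => add_nonneg (by positivity)
    (mul_nonneg (hv x) (sq_nonneg _))) norm_pos.le

lemma IsNeumannGroundState.isRadialNeumann (hμ : 0 < μ) (hL : 0 < L) (V : IsCentralPotential v R)
    (hf : IsNeumannGroundState μ v L f) :
    IsRadialNeumann (fun r => profile v r / μ) (profile f) (neumannEnergy μ v L / μ) L where
  toIsRadialSolutionOn := by
    simp_rw [← sub_div]
    refine isRadialSolutionOn_profile (u := fun x => v x - neumannEnergy μ v L) hμ.ne' hL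
      (fun x y h => by simp only [V.isRadial x y h]) (fun a b =>
      ((isBoundedPotential_profile V.toIsBoundedPotential).intervalIntegrable a b).sub
      intervalIntegrable_const) hf.contDiff
      (hf.isRadial hμ hL V.toIsBoundedPotential V.isRadial) fun φ hφ _ => ?_
    have tested := hf.equation φ hφ
    have mass_integrable : IntegrableOn (fun x => f x * φ x) (Metric.closedBall 0 L) :=
      (hf.contDiff.continuous.mul hφ.continuous).continuousOn.integrableOn_compact
        (isCompact_closedBall 0 L)
    rw [← integral_const_mul, ← sub_eq_zero, ← integral_sub
      (V.integrableOn_weak_form hf.contDiff hφ (isCompact_closedBall 0 L))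
      (mass_integrable.const_mul _)] at tested
    rw [← tested]
    congr with x
    ring
  energy_nonneg := div_nonneg (neumannEnergy_nonneg hμ.le V.nonneg) hμ.le
  pos r hr hrL := hf.pos _ (by rwa [norm_smul_unitVector, abs_of_nonneg hr])
  eq_one := hf.eq_one _ (by rw [norm_smul_unitVector, abs_of_pos hL])
  deriv_eq_zero := by
    have radial_deriv := hf.radial_deriv (L • unitVector E3)
      (by rw [norm_smul_unitVector, abs_of_pos hL])
    rw [map_smul, ← (hasDerivAt_profile (hf.contDiff.differentiable one_ne_zero) L).deriv]
      at radial_deriv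
    exact (smul_eq_zero.1 radial_deriv).resolve_left hL.ne'

end CentralPotential

/-! ### Polar coordinates -/

section Polar

variable {E : Type*} [NormedAddCommGroup E] [NormedSpace ℝ E] [FiniteDimensional ℝ E]
  [MeasurableSpace E] [BorelSpace E] {ν : Measure E} [ν.IsAddHaarMeasure]

lemma ae_of_ae_norm [Nontrivial E] {p : ℝ → Prop} (h : ∀ᵐ x ∂ν, p ‖x‖) :
    ∀ᵐ r : ℝ, 0 < r → p r := by
  classical
  set k : ℝ → ℝ := fun r => if p r then 0 else 1 with k_def
  have k_norm : (fun x : E => k ‖x‖) =ᵐ[ν] 0 := h.mono fun x hx => by simp [k_def, hx]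
  have integrable := (integrable_fun_norm_addHaar ν).1 ((integrable_zero E ℝ ν).congr k_norm.symm)
  have radial_integral := integral_eq_zero_of_ae k_norm
  have ball_pos : 0 < ν.real (Metric.ball 0 1) :=
    ENNReal.toReal_pos (Metric.measure_ball_pos ν 0 one_pos).ne' measure_ball_lt_top.ne
  rw [integral_fun_norm_addHaar, smul_eq_zero_iff_right Module.finrank_pos.ne',
    smul_eq_zero_iff_right ball_pos.ne', setIntegral_eq_zero_iff_of_nonneg_ae
      ((ae_restrict_mem measurableSet_Ioi).mono fun r hr => ?_) integrable,
    Filter.EventuallyEq, ae_restrict_iff' measurableSet_Ioi] at radial_integral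
  · filter_upwards [radial_integral] with r hr hr₀
    by_contra hp
    simpa [k_def, hp, hr₀.ne'] using hr hr₀
  · refine smul_nonneg (pow_nonneg (le_of_lt hr) _) ?_
    simp only [k_def]
    split_ifs <;> simp

lemma lintegral_eq_lintegral_toSphere {h : E → ENNReal} (hh : Measurable h) [Nontrivial E] :
    ∫⁻ x, h x ∂ν = ∫⁻ ω : Metric.sphere (0 : E) 1, ∫⁻ r in Set.Ioi (0 : ℝ),
      ENNReal.ofReal (r ^ (Module.finrank ℝ E - 1)) * h (r • (ω : E))
        ∂(volume : Measure ℝ) ∂ν.toSphere := by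
  set g : Metric.sphere (0 : E) 1 × Set.Ioi (0 : ℝ) → ENNReal := fun p => h (p.2.1 • p.1.1)
  have g_polar (x : ({0}ᶜ : Set E)) : g (homeomorphUnitSphereProd E x) = h x := by
    have : ‖(x : E)‖ ≠ 0 := norm_ne_zero_iff.2 x.2
    simp [g, smul_smul, this]
  have hg : Measurable g := hh.comp (by fun_prop)
  calc ∫⁻ x, h x ∂ν = ∫⁻ x : ({0}ᶜ : Set E), h x ∂(ν.comap (↑)) := by
        rw [lintegral_subtype_comap (measurableSet_singleton _).compl, restrict_compl_singleton]
    _ = ∫⁻ p, g p ∂(ν.toSphere.prod (.volumeIoiPow (Module.finrank ℝ E - 1))) := by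
        rw [← ν.measurePreserving_homeomorphUnitSphereProd.lintegral_comp_emb
          (Homeomorph.measurableEmbedding _)]
        simp_rw [g_polar]
    _ = ∫⁻ ω, ∫⁻ r, g (ω, r) ∂(.volumeIoiPow (Module.finrank ℝ E - 1)) ∂ν.toSphere :=
        lintegral_prod _ hg.aemeasurable
    _ = _ := lintegral_congr fun ω => by
        have h_ray : Measurable fun r : Set.Ioi (0 : ℝ) => h (r.1 • ω.1) := hh.comp (by fun_prop)
        rw [Measure.volumeIoiPow]
        refine (lintegral_withDensity_eq_lintegral_mul _ (by fun_prop) h_ray).trans ?_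
        simp only [Pi.mul_apply]
        rw [← lintegral_subtype_comap measurableSet_Ioi
          fun r : ℝ => ENNReal.ofReal (r ^ (Module.finrank ℝ E - 1)) * h (r • (ω : E))]

end Polar

lemma ae_le_toReal_eLpNorm_top {X : Type*} [MeasurableSpace X] {ν : Measure X} {v : X → ℝ}
    (V : IsBoundedPotential v) : ∀ᵐ x ∂ν, v x ≤ (eLpNorm v ⊤ ν).toReal := by
  obtain ⟨B, hB⟩ := V.bdd
  have finite : eLpNormEssSup v ν ≠ ⊤ := by
    refine (eLpNormEssSup_lt_top_of_ae_bound (C := B) (Eventually.of_forall fun x => ?_)).ne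
    rw [Real.norm_of_nonneg (V.nonneg x)]
    exact hB x
  filter_upwards [ae_le_eLpNormEssSup (f := v) (μ := ν)] with x hx
  have norm_le := ENNReal.toReal_mono finite hx
  rwa [toReal_enorm, Real.norm_of_nonneg (V.nonneg x), ← eLpNorm_exponent_top] at norm_le

lemma IsCentralPotential.ae_profile_le {v : E3 → ℝ} {R : ℝ} (V : IsCentralPotential v R) :
    ∀ᵐ r : ℝ, 0 < r → profile v r ≤ (eLpNorm v ⊤ volume).toReal := by
  refine ae_of_ae_norm (ν := (volume : Measure E3)) ?_
  simpa only [V.isRadial.profile_norm] using ae_le_toReal_eLpNorm_top V.toIsBoundedPotential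

lemma IsScatteringSolution.scatteringLength_eq {μ R : ℝ} {v f : E3 → ℝ} (hμ : 0 < μ)
    (V : IsCentralPotential v R) (hf : IsScatteringSolution μ v f) :
    scatteringLength μ v f = radialFlux (profile f) R := by
  have hf' := hf.isRadial hμ V.toIsBoundedPotential V.isRadial
  rw [(hf.isRadialScattering hμ V).flux_eq R V.radius_pos.le, scatteringLength]
  simp_rw [← V.isRadial.profile_norm, ← hf'.profile_norm]
  rw [integral_comp_norm_of_eq_zero (h := fun r => profile v r * profile f r) V.radius_pos.le
    fun r hr => by rw [V.profile_eq_zero hr, zero_mul], ← intervalIntegral.integral_const_mul,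
    ← intervalIntegral.integral_const_mul]
  refine intervalIntegral.integral_congr fun s _ => ?_
  field_simp

/-! ### Capacity of sets containing a sphere -/

lemma le_integral_sq_mul_deriv_sq {ψ : ℝ → ℝ} {R T : ℝ} (hR : 0 < R) (hRT : R ≤ T)
    (hψ : ContDiff ℝ 1 ψ) (hψR : 1 ≤ ψ R) (hψT : ψ T = 0) :
    R ≤ ∫ r in R..T, r ^ 2 * deriv ψ r ^ 2 := by
  have hψ' := hψ.continuous_deriv le_rfl
  have ne_zero {r} (hr : r ∈ Set.Icc R T) : r ≠ 0 := (hR.trans_le hr.1).ne'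
  have primitive (r) (hr : r ∈ Set.uIcc R T) : HasDerivAt (fun r => -(2 * R) * ψ r + R ^ 2 * r⁻¹)
      (-(2 * R) * deriv ψ r + R ^ 2 * -(r ^ 2)⁻¹) r := by
    rw [Set.uIcc_of_le hRT] at hr
    exact ((hψ.differentiable one_ne_zero r).hasDerivAt.const_mul _).add
      ((hasDerivAt_inv (ne_zero hr)).const_mul _)
  have integrable : IntervalIntegrable
      (fun r => -(2 * R) * deriv ψ r + R ^ 2 * -(r ^ 2)⁻¹) volume R T := by
    refine ContinuousOn.intervalIntegrable ?_
    rw [Set.uIcc_of_le hRT]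
    exact (hψ'.continuousOn.const_mul _).add (continuousOn_const.mul
      (ContinuousOn.inv₀ (by fun_prop) fun r hr => pow_ne_zero 2 (ne_zero hr)).neg)
  calc R ≤ R + R ^ 2 * T⁻¹ + 2 * R * (ψ R - 1) := by
        have := hR.trans_le hRT
        have := sub_nonneg.2 hψR
        linarith [show 0 ≤ R ^ 2 * T⁻¹ + 2 * R * (ψ R - 1) by positivity]
    _ = ∫ r in R..T, (-(2 * R) * deriv ψ r + R ^ 2 * -(r ^ 2)⁻¹) := by
        rw [intervalIntegral.integral_eq_sub_of_hasDerivAt primitive integrable, hψT]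
        field_simp
        ring
    _ ≤ ∫ r in R..T, r ^ 2 * deriv ψ r ^ 2 := by
        refine intervalIntegral.integral_mono_on hRT integrable
          (Continuous.intervalIntegrable (by fun_prop) _ _) fun r hr => ?_
        have expand : (r * deriv ψ r + R / r) ^ 2 =
            r ^ 2 * deriv ψ r ^ 2 + 2 * R * deriv ψ r + R ^ 2 * (r ^ 2)⁻¹ := by
          have := ne_zero hr
          field_simp
          ring
        linarith [sq_nonneg (r * deriv ψ r + R / r)]

section Ray

variable {E : Type*} [NormedAddCommGroup E] [InnerProductSpace ℝ E] [CompleteSpace E] {φ : E → ℝ}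
  {ω : E} {R T : ℝ}

lemma abs_deriv_ray_le_norm_gradient (hφ : Differentiable ℝ φ) (hω : ‖ω‖ = 1) (r : ℝ) :
    |deriv (fun r : ℝ => φ (r • ω)) r| ≤ ‖∇ φ (r • ω)‖ := by
  have ray_deriv : HasDerivAt (fun r : ℝ => φ (r • ω)) (fderiv ℝ φ (r • ω) ω) r :=
    (hφ _).hasFDerivAt.comp_hasDerivAt r
      (((hasDerivAt_id r).smul_const ω).congr_deriv (one_smul ℝ ω))
  rw [ray_deriv.deriv, norm_gradient]
  simpa [hω] using (fderiv ℝ φ (r • ω)).le_opNorm ω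

lemma ofReal_le_lintegral_ray (hR : 0 < R) (hRT : R ≤ T) (hφ : ContDiff ℝ 1 φ) (hω : ‖ω‖ = 1)
    (hφR : 1 ≤ φ (R • ω)) (hφT : φ (T • ω) = 0) :
    ENNReal.ofReal R ≤ ∫⁻ r in Set.Ioi (0 : ℝ), ENNReal.ofReal (r ^ 2) *
      ENNReal.ofReal (‖∇ φ (r • ω)‖ ^ 2) := by
  have hφ' := continuous_gradient hφ
  have hψ : ContDiff ℝ 1 fun r : ℝ => φ (r • ω) := hφ.comp (contDiff_id.smul contDiff_const)
  have := hψ.continuous_deriv le_rfl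
  have integrable : IntervalIntegrable (fun r => r ^ 2 * ‖∇ φ (r • ω)‖ ^ 2) volume R T :=
    Continuous.intervalIntegrable (by fun_prop) R T
  calc ENNReal.ofReal R ≤ ENNReal.ofReal (∫ r in Set.Ioc R T, r ^ 2 * ‖∇ φ (r • ω)‖ ^ 2) := by
        rw [← intervalIntegral.integral_of_le hRT]
        refine ENNReal.ofReal_le_ofReal ((le_integral_sq_mul_deriv_sq hR hRT hψ hφR hφT).trans
          (intervalIntegral.integral_mono_on hRT (Continuous.intervalIntegrable (by fun_prop) _ _)
          integrable fun r _ => ?_))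
        rw [← sq_abs (deriv _ r)]
        gcongr
        exact abs_deriv_ray_le_norm_gradient (hφ.differentiable one_ne_zero) hω r
    _ = ∫⁻ r in Set.Ioc R T, ENNReal.ofReal (r ^ 2) * ENNReal.ofReal (‖∇ φ (r • ω)‖ ^ 2) := by
        simp_rw [← fun r : ℝ => ENNReal.ofReal_mul (q := ‖∇ φ (r • ω)‖ ^ 2) (sq_nonneg r)]
        exact ofReal_integral_eq_lintegral_ofReal integrable.1
          (Eventually.of_forall fun r => by positivity)
    _ ≤ _ := lintegral_mono_set fun r hr => hR.trans hr.1

end Ray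

lemma exists_forall_norm_eq_imp_eq_zero {E : Type*} [SeminormedAddCommGroup E] {φ : E → ℝ}
    (hc : HasCompactSupport φ) (R : ℝ) : ∃ T, R ≤ T ∧ ∀ x, ‖x‖ = T → φ x = 0 := by
  obtain ⟨B, hB⟩ := hc.isCompact.isBounded.subset_closedBall (0 : E)
  refine ⟨max R (B + 1), le_max_left _ _, fun x hx => ?_⟩
  by_contra hne
  have norm_le := mem_closedBall_zero_iff.1 (hB (subset_tsupport _ hne))
  linarith [le_max_right R (B + 1)]

lemma toSphere_univ_E3 :
    (volume : Measure E3).toSphere Set.univ = ENNReal.ofReal (4 * Real.pi) := by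
  rw [Measure.toSphere_apply_univ, EuclideanSpace.volume_ball_fin_three, finrank_euclideanSpace,
    Fintype.card_fin, ENNReal.ofReal_one, one_pow, one_mul, ← ENNReal.ofReal_natCast,
    ← ENNReal.ofReal_mul (by positivity)]
  congr 1
  push_cast
  ring

lemma le_integral_norm_gradient_sq {φ : E3 → ℝ} {R : ℝ} (hR : 0 < R) (hφ : ContDiff ℝ 1 φ)
    (hc : HasCompactSupport φ) (hφR : ∀ x, ‖x‖ = R → 1 ≤ φ x) :
    R ≤ 1 / (4 * Real.pi) * ∫ x, ‖∇ φ x‖ ^ 2 := by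
  have hφ' := continuous_gradient hφ
  have integrable : Integrable fun x => ‖∇ φ x‖ ^ 2 :=
    Continuous.integrable_of_hasCompactSupport (by fun_prop)
      ((hasCompactSupport_gradient hc).comp_left (g := fun y => ‖y‖ ^ 2) (by simp))
  obtain ⟨T, hRT, hφT⟩ := exists_forall_norm_eq_imp_eq_zero hc R
  have norm_smul_sphere {r : ℝ} (hr : 0 ≤ r) (ω : Metric.sphere (0 : E3) 1) :
      ‖r • (ω : E3)‖ = r := by
    rw [norm_smul, norm_eq_of_mem_sphere, mul_one, Real.norm_of_nonneg hr]
  have integrated : ENNReal.ofReal (R * (4 * Real.pi)) ≤ ENNReal.ofReal (∫ x, ‖∇ φ x‖ ^ 2) := by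
    rw [ofReal_integral_eq_lintegral_ofReal integrable
      (Eventually.of_forall fun x => sq_nonneg _), lintegral_eq_lintegral_toSphere (by fun_prop),
      ENNReal.ofReal_mul hR.le, ← toSphere_univ_E3, ← lintegral_const]
    refine lintegral_mono fun ω => ?_
    rw [finrank_euclideanSpace, Fintype.card_fin]
    exact ofReal_le_lintegral_ray hR hRT hφ (norm_eq_of_mem_sphere ω)
      (hφR _ (norm_smul_sphere hR.le ω)) (hφT _ (norm_smul_sphere (hR.le.trans hRT) ω))
  rw [one_div, inv_mul_eq_div, le_div_iff₀ (by positivity)]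
  exact (ENNReal.ofReal_le_ofReal_iff (integral_nonneg fun x => sq_nonneg _)).1 integrated

lemma le_electrostaticCapacity {K : Set E3} {R : ℝ} (hR : 0 < R) (hK : IsCompact K)
    (hRK : Metric.sphere 0 R ⊆ K) : R ≤ electrostaticCapacity K := by
  refine le_csInf ?_ ?_
  · obtain ⟨B, hB⟩ := hK.isBounded.subset_closedBall (0 : E3)
    let b : ContDiffBump (0 : E3) := ⟨max B 1, max B 1 + 1, by positivity, by linarith⟩
    exact ⟨_, b, b.contDiff, b.hasCompactSupport, fun x hx => (b.one_of_mem_closedBall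
      (Metric.closedBall_subset_closedBall (le_max_left _ _) (hB hx))).ge, rfl⟩
  · rintro c ⟨φ, hφ, hc, hφK, rfl⟩
    exact le_integral_norm_gradient_sq hR (hφ.of_le (by exact_mod_cast le_top)) hc
      fun x hx => hφK x (hRK (by simpa using hx))

lemma IsRadial.exists_sphere_subset_tsupport {E : Type*} [NormedAddCommGroup E]
    [InnerProductSpace ℝ E] {v : E → ℝ} {x₀ : E} (hv : IsRadial v) (hc : HasCompactSupport v)
    (hx₀ : v x₀ ≠ 0) : ∃ R, ‖x₀‖ ≤ R ∧ (∀ x, R < ‖x‖ → v x = 0) ∧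
      Metric.sphere 0 R ⊆ tsupport v := by
  have hx₀' : x₀ ∈ tsupport v := subset_tsupport v hx₀
  obtain ⟨y, hy, hmax⟩ := hc.isCompact.exists_isMaxOn ⟨x₀, hx₀'⟩ continuous_norm.continuousOn
  refine ⟨‖y‖, hmax hx₀', fun x hx => ?_, fun x hx => ?_⟩
  · by_contra hvx
    exact (hmax (subset_tsupport v hvx)).not_gt hx
  · obtain ⟨T, rfl⟩ := exists_isometry_of_norm_eq (mem_sphere_zero_iff_norm.1 hx).symm
    refine map_mem_closure T.continuous hy fun z hz => ?_
    rwa [Function.mem_support, hv (T z) z (T.norm_map z)]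

/-! ### Bounds on the Neumann ground state -/

section

variable {μ R L : ℝ} {v f₀ f : E3 → ℝ}

namespace IsCentralPotential

lemma tsupport_subset (V : IsCentralPotential v R) : tsupport v ⊆ Metric.closedBall 0 R := by
  refine closure_minimal (fun x hx => ?_) Metric.isClosed_closedBall
  by_contra hxR
  exact hx (V.eq_zero x (by simpa using hxR))

lemma hasCompactSupport (V : IsCentralPotential v R) : HasCompactSupport v :=
  (isCompact_closedBall 0 R).of_isClosed_subset (isClosed_tsupport v) V.tsupport_subset

lemma integrable_mul {h : E3 → ℝ} (V : IsCentralPotential v R) (hh : Continuous h) :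
    Integrable fun x => v x * h x := by
  have integrableOn : IntegrableOn (fun x => v x * h x) (Metric.closedBall 0 R) :=
    V.toIsBoundedPotential.integrable_mul
      (hh.continuousOn.integrableOn_compact (isCompact_closedBall 0 R))
  exact (integrableOn_iff_integrable_of_support_subset ((Function.support_mul_subset_left v h).trans
    ((subset_tsupport v).trans V.tsupport_subset))).1 integrableOn

lemma ae_profile_div_le (V : IsCentralPotential v R) (hμ : 0 < μ) :
    ∀ᵐ r : ℝ, 0 < r → profile v r / μ ≤ (eLpNorm v ⊤ volume).toReal / μ :=
  V.ae_profile_le.mono fun _ hr hr₀ => div_le_div_of_nonneg_right (hr hr₀) hμ.le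

end IsCentralPotential

namespace IsScatteringSolution

lemma scatteringLength_nonneg (h₀ : IsScatteringSolution μ v f₀) (hμ : 0 < μ)
    (V : IsCentralPotential v R) : 0 ≤ scatteringLength μ v f₀ :=
  h₀.scatteringLength_eq hμ V ▸ (h₀.isRadialScattering hμ V).length_nonneg

lemma scatteringLength_le (h₀ : IsScatteringSolution μ v f₀) (hμ : 0 < μ)
    (V : IsCentralPotential v R) : scatteringLength μ v f₀ ≤ R :=
  h₀.scatteringLength_eq hμ V ▸ (h₀.isRadialScattering hμ V).length_le

lemma profile_norm (h₀ : IsScatteringSolution μ v f₀) (hμ : 0 < μ) (V : IsCentralPotential v R)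
    (x : E3) : profile f₀ ‖x‖ = f₀ x :=
  (h₀.isRadial hμ V.toIsBoundedPotential V.isRadial).profile_norm x

lemma le_one (h₀ : IsScatteringSolution μ v f₀) (hμ : 0 < μ) (V : IsCentralPotential v R)
    (x : E3) : f₀ x ≤ 1 :=
  h₀.profile_norm hμ V x ▸ (h₀.isRadialScattering hμ V).le_one (norm_nonneg x)

lemma one_sub_le_div (h₀ : IsScatteringSolution μ v f₀) (hμ : 0 < μ) (V : IsCentralPotential v R)
    {x : E3} (hx : x ≠ 0) : 1 - f₀ x ≤ scatteringLength μ v f₀ / ‖x‖ := by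
  rw [h₀.scatteringLength_eq hμ V, ← h₀.profile_norm hμ V x]
  linarith [(h₀.isRadialScattering hμ V).one_sub_div_le (norm_pos_iff.2 hx)]

lemma exp_neg_le (h₀ : IsScatteringSolution μ v f₀) (hμ : 0 < μ) (V : IsCentralPotential v R)
    (x : E3) : Real.exp (-(√(zetaZero R v) / √μ)) ≤ f₀ x := by
  set M := (eLpNorm v ⊤ volume).toReal with M_def
  have S := h₀.isRadialScattering hμ V
  have sqrt_zetaZero : √(zetaZero R v) / √μ = √(M / μ) * R := by
    rw [zetaZero, Real.sqrt_mul (sq_nonneg R), Real.sqrt_sq V.radius_pos.le, ← M_def,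
      Real.sqrt_div' _ hμ.le]
    ring
  have hw : ∀ᵐ r : ℝ, 0 < r → profile v r / μ ≤ √(M / μ) ^ 2 := by
    rw [Real.sq_sqrt (div_nonneg ENNReal.toReal_nonneg hμ.le)]
    exact V.ae_profile_div_le hμ
  rw [sqrt_zetaZero, ← h₀.profile_norm hμ V x]
  exact (S.exp_neg_le (Real.sqrt_nonneg _) hw).trans
    (S.monotoneOn Set.self_mem_Ici (norm_nonneg x) (norm_nonneg x))

lemma integral_mul (hμ : μ ≠ 0) : ∫ x, v x * f₀ x = 4 * Real.pi * μ * scatteringLength μ v f₀ := by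
  rw [scatteringLength]
  field_simp

end IsScatteringSolution

namespace IsNeumannGroundState

lemma profile_norm (h : IsNeumannGroundState μ v L f) (hμ : 0 < μ) (hL : 0 < L)
    (V : IsCentralPotential v R) (x : E3) : profile f ‖x‖ = f x :=
  (h.isRadial hμ hL V.toIsBoundedPotential V.isRadial).profile_norm x

lemma energy_le (h : IsNeumannGroundState μ v L f) (h₀ : IsScatteringSolution μ v f₀) (hμ : 0 < μ)
    (V : IsCentralPotential v R) (hRL : 100 * R ≤ L) :
    neumannEnergy μ v L ≤ 3 * μ * scatteringLength μ v f₀ / L ^ 3 * (1 + 4 * (R / L)) := by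
  have hL : 0 < L := by linarith [V.radius_pos]
  have radial_energy_le :=
    (h.isRadialNeumann hμ hL V).energy_le (h₀.isRadialScattering hμ V) hRL
  have ha := h₀.scatteringLength_nonneg hμ V
  have haR := h₀.scatteringLength_le hμ V
  rw [← h₀.scatteringLength_eq hμ V, div_le_iff₀ hμ] at radial_energy_le
  set a := scatteringLength μ v f₀
  calc neumannEnergy μ v L ≤ 3 * a / L ^ 3 * (1 + 4 * (a / L)) * μ := radial_energy_le
    _ ≤ 3 * a / L ^ 3 * (1 + 4 * (R / L)) * μ := by gcongr
    _ = 3 * μ * a / L ^ 3 * (1 + 4 * (R / L)) := by ring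

lemma le_one (h : IsNeumannGroundState μ v L f) (h₀ : IsScatteringSolution μ v f₀) (hμ : 0 < μ)
    (V : IsCentralPotential v R) (hRL : 100 * R ≤ L) (x : E3) : f x ≤ 1 := by
  have hL : 0 < L := by linarith [V.radius_pos]
  rcases le_total ‖x‖ L with hx | hx
  · exact h.profile_norm hμ hL V x ▸ (h.isRadialNeumann hμ hL V).le_one
      (h₀.isRadialScattering hμ V) hRL (norm_nonneg x) hx
  · exact (h.eq_one x hx).le

lemma scattering_le (h : IsNeumannGroundState μ v L f) (h₀ : IsScatteringSolution μ v f₀)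
    (hμ : 0 < μ) (hL : 0 < L) (V : IsCentralPotential v R) (x : E3) : f₀ x ≤ f x := by
  rcases le_total ‖x‖ L with hx | hx
  · rw [← h₀.profile_norm hμ V, ← h.profile_norm hμ hL V]
    exact (h.isRadialNeumann hμ hL V).scattering_le (h₀.isRadialScattering hμ V) (norm_nonneg x) hx
  · exact (h₀.le_one hμ V x).trans (h.eq_one x hx).ge

lemma abs_sub_le_mul (h : IsNeumannGroundState μ v L f) (h₀ : IsScatteringSolution μ v f₀)
    (hμ : 0 < μ) (V : IsCentralPotential v R) (hRL : 100 * R ≤ L) {x : E3} (hx : ‖x‖ ≤ L) :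
    |f₀ x - f x| ≤ 2 * (scatteringLength μ v f₀ / L) * f₀ x := by
  have hL : 0 < L := by linarith [V.radius_pos]
  rw [h₀.scatteringLength_eq hμ V, ← h₀.profile_norm hμ V, ← h.profile_norm hμ hL V]
  exact (h.isRadialNeumann hμ hL V).abs_sub_le (h₀.isRadialScattering hμ V) hRL (norm_nonneg x) hx

lemma abs_sub_le (h : IsNeumannGroundState μ v L f) (h₀ : IsScatteringSolution μ v f₀) (hμ : 0 < μ)
    (V : IsCentralPotential v R) (hRL : 100 * R ≤ L) (x : E3) :
    |f₀ x - f x| ≤ 2 * (scatteringLength μ v f₀ / L) := by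
  have hL : 0 < L := by linarith [V.radius_pos]
  have ha := h₀.scatteringLength_nonneg hμ V
  rcases le_total ‖x‖ L with hx | hx
  · exact (h.abs_sub_le_mul h₀ hμ V hRL hx).trans
      (mul_le_of_le_one_right (by positivity) (h₀.le_one hμ V x))
  · have hx₀ : x ≠ 0 := norm_pos_iff.1 (hL.trans_le hx)
    rw [abs_sub_comm, abs_of_nonneg (sub_nonneg.2 (h.scattering_le h₀ hμ hL V x)), h.eq_one x hx]
    calc 1 - f₀ x ≤ scatteringLength μ v f₀ / ‖x‖ := h₀.one_sub_le_div hμ V hx₀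
      _ ≤ scatteringLength μ v f₀ / L := by gcongr
      _ ≤ 2 * (scatteringLength μ v f₀ / L) := le_mul_of_one_le_left (by positivity) one_le_two

lemma abs_integral_mul_sub_le (h : IsNeumannGroundState μ v L f)
    (h₀ : IsScatteringSolution μ v f₀) (hμ : 0 < μ) (V : IsCentralPotential v R)
    (hRL : 100 * R ≤ L) : |(∫ x, v x * f x) - 4 * Real.pi * μ * scatteringLength μ v f₀| ≤
      2 * (∫ x, v x) * (scatteringLength μ v f₀ / L) := by
  rw [← IsScatteringSolution.integral_mul hμ.ne', ← integral_sub
    (V.integrable_mul h.contDiff.continuous) (V.integrable_mul h₀.contDiff.continuous)]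
  calc |∫ x, (v x * f x - v x * f₀ x)| ≤ ∫ x, v x * (2 * (scatteringLength μ v f₀ / L)) := by
        refine norm_integral_le_of_norm_le (f := fun x => v x * f x - v x * f₀ x)
          (V.integrable_mul continuous_const) (Eventually.of_forall fun x => ?_)
        rw [← mul_sub, norm_mul, Real.norm_of_nonneg (V.nonneg x), Real.norm_eq_abs, abs_sub_comm]
        exact mul_le_mul_of_nonneg_left (h.abs_sub_le h₀ hμ V hRL x) (V.nonneg x)
    _ = 2 * (∫ x, v x) * (scatteringLength μ v f₀ / L) := by
        rw [integral_mul_const]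
        ring

lemma abs_mul_sq_sub_mul_sq_le (h : IsNeumannGroundState μ v L f)
    (h₀ : IsScatteringSolution μ v f₀) (hμ : 0 < μ) (V : IsCentralPotential v R)
    (hRL : 100 * R ≤ L) (x : E3) : |v x * f x ^ 2 - v x * f₀ x ^ 2| ≤
      4 * (scatteringLength μ v f₀ / L) * (v x * f₀ x) := by
  have hL : 0 < L := by linarith [V.radius_pos]
  rcases le_or_gt ‖x‖ L with hx | hx
  · have hv := V.nonneg x
    have hf₀ := h₀.nonneg hμ V.toIsBoundedPotential x
    have add_nonneg : 0 ≤ f x + f₀ x := by linarith [h.scattering_le h₀ hμ hL V x]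
    have add_le_two : f x + f₀ x ≤ 2 := by linarith [h₀.le_one hμ V x, h.le_one h₀ hμ V hRL x]
    have ha := h₀.scatteringLength_nonneg hμ V
    calc |v x * f x ^ 2 - v x * f₀ x ^ 2| = v x * (|f₀ x - f x| * (f x + f₀ x)) := by
          rw [← mul_sub, sq_sub_sq, abs_mul, abs_mul, abs_of_nonneg hv, abs_of_nonneg add_nonneg,
            abs_sub_comm (f x), mul_comm (f x + f₀ x)]
      _ ≤ v x * (2 * (scatteringLength μ v f₀ / L) * f₀ x * 2) := by
          gcongr
          exact h.abs_sub_le_mul h₀ hμ V hRL hx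
      _ = 4 * (scatteringLength μ v f₀ / L) * (v x * f₀ x) := by ring
  · rw [V.eq_zero x (by linarith [V.radius_pos])]
    simp

lemma abs_integral_mul_sq_sub_le (h : IsNeumannGroundState μ v L f)
    (h₀ : IsScatteringSolution μ v f₀) (hμ : 0 < μ) (V : IsCentralPotential v R)
    (hRL : 100 * R ≤ L) : |(∫ x, v x * f x ^ 2) - ∫ x, v x * f₀ x ^ 2| ≤
      16 * Real.pi * R * (μ * scatteringLength μ v f₀ / L) := by
  have hL : 0 < L := by linarith [V.radius_pos]
  have hf := h.contDiff.continuous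
  have hf₀ := h₀.contDiff.continuous
  have ha := h₀.scatteringLength_nonneg hμ V
  have haR := h₀.scatteringLength_le hμ V
  rw [← integral_sub (V.integrable_mul (h := fun x => f x ^ 2) (hf.pow 2))
    (V.integrable_mul (h := fun x => f₀ x ^ 2) (hf₀.pow 2))]
  calc |∫ x, (v x * f x ^ 2 - v x * f₀ x ^ 2)|
      ≤ ∫ x, 4 * (scatteringLength μ v f₀ / L) * (v x * f₀ x) :=
        norm_integral_le_of_norm_le (f := fun x => v x * f x ^ 2 - v x * f₀ x ^ 2)
          ((V.integrable_mul hf₀).const_mul _)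
          (Eventually.of_forall (h.abs_mul_sq_sub_mul_sq_le h₀ hμ V hRL))
    _ = 16 * Real.pi * scatteringLength μ v f₀ * (μ * scatteringLength μ v f₀ / L) := by
        rw [integral_const_mul, IsScatteringSolution.integral_mul hμ.ne']
        ring
    _ ≤ 16 * Real.pi * R * (μ * scatteringLength μ v f₀ / L) := by gcongr

lemma norm_gradient_le (h : IsNeumannGroundState μ v L f) (hμ : 0 < μ) (hL : 0 < L)
    (V : IsCentralPotential v R) {x : E3} {c : ℝ} (hc : 0 ≤ c)
    (hx : 0 < ‖x‖ → ‖x‖ ≤ L → |deriv (profile f) ‖x‖| ≤ c) : ‖∇ f x‖ ≤ c := by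
  have hf := h.isRadial hμ hL V.toIsBoundedPotential V.isRadial
  have hf' := h.contDiff.differentiable one_ne_zero
  rcases eq_or_ne x 0 with rfl | hx₀
  · rwa [hf.gradient_zero hf', norm_zero]
  rcases le_or_gt ‖x‖ L with hxL | hxL
  · exact hf.norm_gradient hf' x ▸ hx (norm_pos_iff.2 hx₀) hxL
  · rwa [gradient_eq_zero_of_lt_norm h.eq_one hxL, norm_zero]

lemma norm_gradient_le_div_sq (h : IsNeumannGroundState μ v L f)
    (h₀ : IsScatteringSolution μ v f₀) (hμ : 0 < μ) (V : IsCentralPotential v R)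
    (hRL : 100 * R ≤ L) (x : E3) :
    ‖∇ f x‖ ≤ scatteringLength μ v f₀ * (1 + 2 * (R / L)) / ‖x‖ ^ 2 := by
  have hR := V.radius_pos
  have hL : 0 < L := by linarith
  have ha := h₀.scatteringLength_nonneg hμ V
  refine h.norm_gradient_le hμ hL V (by positivity) fun hx hxL => ?_
  rw [h₀.scatteringLength_eq hμ V]
  exact (h.isRadialNeumann hμ hL V).abs_deriv_le_div_sq (h₀.isRadialScattering hμ V) hRL hx hxL

lemma norm_gradient_le_div (h : IsNeumannGroundState μ v L f) (h₀ : IsScatteringSolution μ v f₀)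
    (hμ : 0 < μ) (V : IsCentralPotential v R) (hRL : 100 * R ≤ L) (x : E3) :
    ‖∇ f x‖ ≤ 2 / ‖x‖ := by
  have hL : 0 < L := by linarith [V.radius_pos]
  exact h.norm_gradient_le hμ hL V (by positivity) fun hx hxL =>
    (h.isRadialNeumann hμ hL V).abs_deriv_le_div (h₀.isRadialScattering hμ V) hRL hx hxL

lemma norm_gradient_le_of_radius_le {R₀ : ℝ} (h : IsNeumannGroundState μ v L f)
    (h₀ : IsScatteringSolution μ v f₀) (hμ : 0 < μ) (V : IsCentralPotential v R) (hR₀ : R ≤ R₀)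
    (hRL : 100 * R₀ ≤ L) (x : E3) : ‖∇ f x‖ ≤ 4 / (‖x‖ ^ 2 + R₀ ^ 2) *
      (scatteringLength μ v f₀ + (R - scatteringLength μ v f₀) / μ * zetaZero R₀ v) := by
  have hL : 0 < L := by linarith [V.radius_pos]
  have ha := h₀.scatteringLength_nonneg hμ V
  have haR := sub_nonneg.2 (h₀.scatteringLength_le hμ V)
  set M := (eLpNorm v ⊤ volume).toReal
  have : 0 ≤ M := ENNReal.toReal_nonneg
  have zetaZero_eq : (R - scatteringLength μ v f₀) / μ * zetaZero R₀ v =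
      (R - scatteringLength μ v f₀) * (M / μ * R₀ ^ 2) := by
    rw [zetaZero]
    ring
  rw [zetaZero_eq]
  refine h.norm_gradient_le hμ hL V (by positivity) fun hx hxL => ?_
  rw [h₀.scatteringLength_eq hμ V]
  exact (h.isRadialNeumann hμ hL V).abs_deriv_le_of_ae_le (h₀.isRadialScattering hμ V) hR₀ hRL
    (by positivity) (V.ae_profile_div_le hμ) hx hxL

lemma gradient_eq_zero_of_ae_eq_zero (h : IsNeumannGroundState μ v L f)
    (h₀ : IsScatteringSolution μ v f₀) (hμ : 0 < μ) (V : IsCentralPotential v R)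
    (hRL : 100 * R ≤ L) (hv : v =ᵐ[volume] 0) (x : E3) : ∇ f x = 0 := by
  have scatteringLength_eq_zero : scatteringLength μ v f₀ = 0 := by
    rw [scatteringLength, integral_eq_zero_of_ae (hv.mono fun x hx => by simp [hx]), mul_zero]
  simpa [scatteringLength_eq_zero] using h.norm_gradient_le_div_sq h₀ hμ V hRL x

lemma norm_gradient_le_capacity (h : IsNeumannGroundState μ v L f)
    (h₀ : IsScatteringSolution μ v f₀) (hμ : 0 < μ) (V : IsCentralPotential v R)
    (hRL : 100 * R ≤ L) (x : E3) : ‖∇ f x‖ ≤ 4 / (‖x‖ ^ 2 + R ^ 2) *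
      (scatteringLength μ v f₀ +
        (electrostaticCapacity (tsupport v) - scatteringLength μ v f₀) / μ * zetaZero R v) := by
  by_cases h_ne : ∃ y, y ≠ 0 ∧ v y ≠ 0
  · obtain ⟨y, hy, hvy⟩ := h_ne
    obtain ⟨ρ, hyρ, hvρ, sphere_subset⟩ :=
      V.isRadial.exists_sphere_subset_tsupport V.hasCompactSupport hvy
    have V' : IsCentralPotential v ρ :=
      ⟨V.toIsBoundedPotential, (norm_pos_iff.2 hy).trans_le hyρ, V.isRadial, hvρ⟩
    have hρR : ρ ≤ R := by
      have norm_eq : ‖ρ • unitVector E3‖ = ρ := by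
        rw [norm_smul_unitVector, abs_of_pos V'.radius_pos]
      have mem_tsupport := sphere_subset (mem_sphere_zero_iff_norm.2 norm_eq)
      exact norm_eq ▸ mem_closedBall_zero_iff.1 (V.tsupport_subset mem_tsupport)
    refine (h.norm_gradient_le_of_radius_le h₀ hμ V' hρR hRL x).trans ?_
    have hζ : 0 ≤ zetaZero R v := mul_nonneg (sq_nonneg R) ENNReal.toReal_nonneg
    have hcap := le_electrostaticCapacity V'.radius_pos V.hasCompactSupport.isCompact sphere_subset
    gcongr
  · push Not at h_ne
    have hv : v =ᵐ[volume] 0 := by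
      filter_upwards [compl_mem_ae_iff.2 (measure_singleton (0 : E3))] with y hy
      exact h_ne y hy
    have zetaZero_eq_zero : zetaZero R v = 0 := by simp [zetaZero, eLpNorm_congr_ae hv]
    have ha := h₀.scatteringLength_nonneg hμ V
    rw [h.gradient_eq_zero_of_ae_eq_zero h₀ hμ V hRL hv x, zetaZero_eq_zero, norm_zero, mul_zero,
      add_zero]
    positivity

end IsNeumannGroundState

end

theorem mainTheorem4 :
    ∃ C : ℝ, 0 < C ∧
      ∀ (R₀ : ℝ) (v : E3 → ℝ), 0 < R₀ → Measurable v → (∀ x, 0 ≤ v x) → (∃ M, ∀ x, v x ≤ M) →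
      (∀ x y, ‖x‖ = ‖y‖ → v x = v y) → (∀ x, R₀ < ‖x‖ → v x = 0) →
      ∀ (μ L : ℝ), 0 < μ → C * R₀ ≤ L →
      ∀ (f₀ f : E3 → ℝ), IsScatteringSolution μ v f₀ → IsNeumannGroundState μ v L f →
      -- (i) the ground state energy
      neumannEnergy μ v L ≤ 3 * μ * scatteringLength μ v f₀ / L ^ 3 * (1 + C * (R₀ / L)) ∧
      -- (ii) pointwise bounds
      (∀ x, Real.exp (-(Real.sqrt (zetaZero R₀ v) / Real.sqrt μ)) ≤ f x ∧ f x ≤ 1) ∧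
      (∀ x, x ≠ 0 → 1 - f x ≤
        min (1 - Real.exp (-(Real.sqrt (zetaZero R₀ v) / Real.sqrt μ)))
          (scatteringLength μ v f₀ / ‖x‖)) ∧
      (∀ x, |f₀ x - f x| ≤ C * (scatteringLength μ v f₀ / L)) ∧
      -- (iii) approximation of the scattering length
      |(∫ x, v x * f x) - 4 * Real.pi * μ * scatteringLength μ v f₀| ≤
        C * (∫ x, v x) * (scatteringLength μ v f₀ / L) ∧
      |(∫ x, v x * f x ^ 2) - ∫ x, v x * f₀ x ^ 2| ≤
        C * R₀ * (μ * scatteringLength μ v f₀ / L) ∧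
      -- (iv) pointwise gradient bounds
      (∀ x, x ≠ 0 →
        ‖gradient f x‖ ≤ scatteringLength μ v f₀ * (1 + C * (R₀ / L)) / ‖x‖ ^ 2 ∧
        ‖gradient f x‖ ≤ (2 + C * (R₀ / L)) / ‖x‖) ∧
      -- (v) gradient bound with a constant independent of μ
      (∀ x, ‖gradient f x‖ ≤ C / (‖x‖ ^ 2 + R₀ ^ 2) *
        (scatteringLength μ v f₀ +
          (electrostaticCapacity (tsupport v) - scatteringLength μ v f₀) / μ *
            zetaZero R₀ v)) := by
  refine ⟨100, by norm_num, fun R₀ v hR₀ hv hv₀ hvB hrad hsupp μ L hμ hRL f₀ f h₀ h => ?_⟩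
  have V : IsCentralPotential v R₀ := ⟨⟨hv, hv₀, hvB⟩, hR₀, hrad, hsupp⟩
  have hL : 0 < L := by linarith
  have ha := h₀.scatteringLength_nonneg hμ V
  have h_int : 0 ≤ ∫ x, v x := integral_nonneg fun x => hv₀ x
  have f₀_le (x) := h.scattering_le h₀ hμ hL V x
  have exp_le (x) := (h₀.exp_neg_le hμ V x).trans (f₀_le x)
  refine ⟨(h.energy_le h₀ hμ V hRL).trans (by gcongr; norm_num),
    fun x => ⟨exp_le x, h.le_one h₀ hμ V hRL x⟩,
    fun x hx => le_min (sub_le_sub_left (exp_le x) 1)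
      ((sub_le_sub_left (f₀_le x) 1).trans (h₀.one_sub_le_div hμ V hx)),
    fun x => (h.abs_sub_le h₀ hμ V hRL x).trans (by gcongr; norm_num),
    (h.abs_integral_mul_sub_le h₀ hμ V hRL).trans (by gcongr; norm_num),
    (h.abs_integral_mul_sq_sub_le h₀ hμ V hRL).trans (by gcongr; linarith [Real.pi_lt_four]),
    fun x _ => ⟨(h.norm_gradient_le_div_sq h₀ hμ V hRL x).trans (by gcongr; norm_num),
      (h.norm_gradient_le_div h₀ hμ V hRL x).trans
        (by gcongr; exact le_add_of_nonneg_right (by positivity))⟩,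
    fun x => ?_⟩
  have gradient_le := h.norm_gradient_le_capacity h₀ hμ V hRL x
  have bound_nonneg := (norm_nonneg _).trans gradient_le
  exact (gradient_le.trans (le_mul_of_one_le_left bound_nonneg
    (by norm_num : (1 : ℝ) ≤ 25))).trans_eq (by ring)
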